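/- Let $K$ be an algebraically closed field of characteristic zero (for instance $K=\mathbb C$), let $\mathfrak g$ be a finite-dimensional Lie algebra over $K$ and let $\rho:\mathfrak g\to \mathrm{gl}(V)$ be a representation on a finite-dimensional $K$-vector space $V$. For $x\in V$ let $R_x:\mathfrak g\to V$, $R_x(\xi)=\rho(\xi)x$. A point $a \in V$ is regular if $\dim \mathrm{Ker}\, R_a\le\dim \mathrm{Ker}\, R_x$ for all $x\in V$; let $\mathsf{Sing}\subset V$ be the set of non-regular points, i.e. $\mathsf{Sing}=\{y\in V : \mathrm{rk}\,R_y<\max_{x\in V}\mathrm{rk}\,R_x\}$. Its codimension $\operatorname{codim}\mathsf{Sing}$ in $V$ is the height of the ideal of polynomials on $V$ vanishing on $\mathsf{Sing}$ (so the empty set has codimension $\infty$). For $x,a\in V$ consider the pencil $R_x+\lambda R_a=R_{x+\lambda a}$ and its Kronecker canonical form: in suitable bases of $\mathfrak g$ and $V$ it is block-diagonal, the blocks being Jordan blocks (with eigenvalue in $K\cup\{\infty\}$), horizontal Kronecker blocks of size $\varepsilon\times(\varepsilon+1)$ and vertical Kronecker blocks of size $(\eta+1)\times\eta$, where $\varepsilon,\eta\ge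 0$. The algebraic type of the pencil consists of the sizes of its Kronecker blocks, the number of distinct eigenvalues of its Jordan blocks, and the number and sizes of the Jordan blocks belonging to each eigenvalue. A pair $(x,a)\in V\times V$, and the pencil $R_x+\lambda R_a$, is called generic if $(x,a)$ belongs to a Zariski open subset of $V\times V$ on which the algebraic type is constant. Then a generic pencil $R_x+\lambda R_a$ has no Jordan blocks if and only if $\operatorname{codim}\mathsf{Sing}\ge 2$. That is: for every generic pair $(x,a)$, the pencil $R_x+\lambda R_a$ has no Jordan blocks if and only if $\operatorname{codim}\mathsf{Sing}\ge 2$; moreover, there is a non-empty Zariski open subset of $V\times V$ such that for every pair $(x,a)$ in it the same equivalence holds. -/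

import Mathlib

/-! ### Kronecker canonical form of a pair of linear maps -/

/-- The blocks of the Kronecker canonical form of a pencil `A + t B` over `K`.
* `jordan n ev`: Jordan block of size `(n + 1) × (n + 1)` with eigenvalue `ev ∈ K ∪ {∞}`
  (Jordan blocks are never empty);
* `horizontal e`: horizontal Kronecker block of size `e × (e + 1)`;
* `vertical e`: vertical Kronecker block of size `(e + 1) × e`.
A zero block of size `g × h` is the sum of `g` blocks `vertical 0` and `h` blocks
`horizontal 0`. -/
inductive PencilBlock (K : Type*) where
  | jordan (n : ℕ) (ev : OnePoint K) : PencilBlock K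
  | horizontal (e : ℕ) : PencilBlock K
  | vertical (e : ℕ) : PencilBlock K

namespace PencilBlock

/-- Number of rows of a block. -/
def rows {K : Type*} : PencilBlock K → ℕ
  | jordan n _ => n + 1
  | horizontal e => e
  | vertical e => e + 1

/-- Number of columns of a block. -/
def cols {K : Type*} : PencilBlock K → ℕ
  | jordan n _ => n + 1
  | horizontal e => e + 1
  | vertical e => e

/-- Entry in row `i` and column `j` of the first matrix of a block. -/
noncomputable def entryA {K : Type*} [Field K] : PencilBlock K → ℕ → ℕ → K
  | jordan _ ev, i, j =>
      ev.elim (if i = j then 1 else 0)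
        (fun c => if i = j then c else if i + 1 = j then 1 else 0)
  | horizontal _, i, j => if i = j then 1 else 0
  | vertical _, i, j => if i = j then 1 else 0

/-- Entry in row `i` and column `j` of the second matrix of a block. -/
noncomputable def entryB {K : Type*} [Field K] : PencilBlock K → ℕ → ℕ → K
  | jordan _ ev, i, j =>
      ev.elim (if i + 1 = j then 1 else 0) (fun _ => if i = j then 1 else 0)
  | horizontal _, i, j => if i + 1 = j then 1 else 0
  | vertical _, i, j => if i = j + 1 then 1 else 0

/-- The first matrix of a block. -/
noncomputable def matA {K : Type*} [Field K] (b : PencilBlock K) :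
    Matrix (Fin b.rows) (Fin b.cols) K :=
  Matrix.of fun i j => b.entryA i j

/-- The second matrix of a block. -/
noncomputable def matB {K : Type*} [Field K] (b : PencilBlock K) :
    Matrix (Fin b.rows) (Fin b.cols) K :=
  Matrix.of fun i j => b.entryB i j

/-- The block is a Jordan block (with finite or infinite eigenvalue). -/
def IsJordan {K : Type*} : PencilBlock K → Prop
  | jordan _ _ => True
  | horizontal _ => False
  | vertical _ => False

/-- Replace the eigenvalue of a Jordan block by its image under `s`; Kronecker blocks are
unchanged. -/
def relabel {K : Type*} (s : Equiv.Perm (OnePoint K)) : PencilBlock K → PencilBlock K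
  | jordan n ev => jordan n (s ev)
  | horizontal e => horizontal e
  | vertical e => vertical e

end PencilBlock

/-- In suitable bases of `U` and `V` the linear maps `A, B : U → V` are simultaneously
block-diagonal with the blocks `b 0, …, b (k - 1)`. -/
def IsKroneckerForm {K U V : Type*} [Field K] [AddCommGroup U] [Module K U]
    [AddCommGroup V] [Module K V] (A B : U →ₗ[K] V) {k : ℕ} (b : Fin k → PencilBlock K) : Prop :=
  ∃ (bU : Module.Basis (Σ i, Fin (b i).cols) K U) (bV : Module.Basis (Σ i, Fin (b i).rows) K V),
    LinearMap.toMatrix bU bV A = Matrix.blockDiagonal' (fun i => (b i).matA) ∧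
    LinearMap.toMatrix bU bV B = Matrix.blockDiagonal' (fun i => (b i).matB)

/-- The Kronecker canonical form of the pencil `A + t B` contains no Jordan blocks. -/
def HasNoJordanBlocks {K U V : Type*} [Field K] [AddCommGroup U] [Module K U]
    [AddCommGroup V] [Module K V] (A B : U →ₗ[K] V) : Prop :=
  ∃ (k : ℕ) (b : Fin k → PencilBlock K), IsKroneckerForm A B b ∧ ∀ i, ¬ (b i).IsJordan

/-- Two pencils have the same algebraic type: the same minimal row and column indices, and, up
to a bijective renaming of the eigenvalues, the same Jordan blocks. -/
def SameAlgebraicType {K U V : Type*} [Field K] [AddCommGroup U] [Module K U]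
    [AddCommGroup V] [Module K V] (A B A' B' : U →ₗ[K] V) : Prop :=
  ∃ (k : ℕ) (b : Fin k → PencilBlock K) (s : Equiv.Perm (OnePoint K)),
    IsKroneckerForm A B b ∧ IsKroneckerForm A' B' (fun i => (b i).relabel s)

/-! ### Zariski topology and codimension in a finite-dimensional vector space -/

/-- `S` is Zariski open in the finite-dimensional space `W`: it is the set where some polynomial
of a given set of polynomials (in linear coordinates) does not vanish. -/
def IsZariskiOpen (K : Type*) {W : Type*} [Field K] [AddCommGroup W] [Module K W]
    [FiniteDimensional K W] (S : Set W) : Prop :=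
  ∃ P : Set (MvPolynomial (Fin (Module.finrank K W)) K),
    S = {w | ∃ p ∈ P, MvPolynomial.eval ((Module.finBasis K W).equivFun w) p ≠ 0}

/-- Codimension of (the Zariski closure of) a subset `S` of the finite-dimensional space `W`: the
height of the ideal of all polynomials (in linear coordinates) vanishing on `S`. The empty set
has codimension `⊤`. -/
noncomputable def zariskiCodim (K : Type*) {W : Type*} [Field K] [AddCommGroup W] [Module K W]
    [FiniteDimensional K W] (S : Set W) : ℕ∞ :=
  (MvPolynomial.vanishingIdeal K ((Module.finBasis K W).equivFun '' S)).height

/-! ### Representations of Lie algebras -/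

-- The Lie bracket on `Module.End K V` is the commutator.
attribute [local instance 100] LieRing.ofAssociativeRing

namespace LieRep

/-- The operator `R_x : 𝔤 → V`, `R_x ξ = ρ(ξ) x`, which depends linearly on `x`. -/
def R {K 𝔤 V : Type*} [Field K] [LieRing 𝔤] [LieAlgebra K 𝔤] [AddCommGroup V] [Module K V]
    (ρ : 𝔤 →ₗ⁅K⁆ Module.End K V) : V →ₗ[K] 𝔤 →ₗ[K] V :=
  LinearMap.flip (ρ : 𝔤 →ₗ[K] V →ₗ[K] V)

/-- The stabiliser `St_x = Ker R_x`. -/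
def stabiliser {K 𝔤 V : Type*} [Field K] [LieRing 𝔤] [LieAlgebra K 𝔤] [AddCommGroup V]
    [Module K V] (ρ : 𝔤 →ₗ⁅K⁆ Module.End K V) (x : V) : Submodule K 𝔤 :=
  LinearMap.ker (R ρ x)

/-- A point is regular if its stabiliser has minimal dimension (equivalently, `rk R_a`, the
dimension of the orbit of `a`, is maximal). -/
def IsRegular {K 𝔤 V : Type*} [Field K] [LieRing 𝔤] [LieAlgebra K 𝔤] [AddCommGroup V]
    [Module K V] (ρ : 𝔤 →ₗ⁅K⁆ Module.End K V) (a : V) : Prop :=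
  ∀ x : V, Module.finrank K (stabiliser ρ a) ≤ Module.finrank K (stabiliser ρ x)

/-- The set of singular (that is, non-regular) points. -/
def Sing {K 𝔤 V : Type*} [Field K] [LieRing 𝔤] [LieAlgebra K 𝔤] [AddCommGroup V]
    [Module K V] (ρ : 𝔤 →ₗ⁅K⁆ Module.End K V) : Set V :=
  {y | ¬ IsRegular ρ y}

/-- The pair `(x, a)` is generic: it lies in a Zariski open subset of `V × V` on which the
algebraic type of the pencil `R_x + t R_a` is constant. -/
def IsGenericPair {K 𝔤 V : Type*} [Field K] [LieRing 𝔤] [LieAlgebra K 𝔤] [AddCommGroup V]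
    [Module K V] [FiniteDimensional K V] (ρ : 𝔤 →ₗ⁅K⁆ Module.End K V) (x a : V) : Prop :=
  ∃ S : Set (V × V), IsZariskiOpen K S ∧ (x, a) ∈ S ∧
    ∀ p ∈ S, ∀ q ∈ S, SameAlgebraicType (R ρ p.1) (R ρ p.2) (R ρ q.1) (R ρ q.2)

end LieRep

/-! A pencil has no Jordan blocks exactly when all its nonzero members `α A + β B` have the same
rank. Kronecker blocks have full rank at every `(α, β) ≠ 0`, while a Jordan block drops rank at its
eigenvalue (`HasConstantRank.not_isJordan`). Conversely, let the rank be constant and take a maximal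
`P` which every nonzero member maps onto one and the same `N`. The induced pencil `U ⧸ P → V ⧸ N` is
then injective (`HasConstantRank.exists_isSurjectiveOn`), hence a sum of vertical blocks by
induction on dimension (`IsInjectivePencil.isVerticalSum`). The dual of `P → N` is injective as
well, so `P → N` is a sum of horizontal blocks, and the extension splits because chains lift
(`exists_chain_lift`).

The members of the pencil of `(x, a)` are the operators `R_{α x + β a}`. For regular `a`, constant
rank therefore means that the line `x + t a` misses `Sing`, which is the common zero set of the
minors of maximal order. Its codimension is at least 2 iff no prime polynomial divides all these
minors. If a prime `q` does, a generic line meets `q = 0`, since `q (x + t a)` has positive degree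
in `t`. If none does, the polynomials `p (x + t a)` have no common factor in `K[x, a][t]`;
eliminating `t` gives a nonzero `d (x, a)` in their ideal, and the line misses `Sing` wherever `d ≠
0`.

This settles the claim on a nonempty open set. That set meets every nonempty open set on which the
algebraic type is constant, which settles it for every generic pair. -/

/-! ### Ranks of block-diagonal matrices and of the canonical blocks -/

open Matrix in
theorem Matrix.finrank_ker_mulVecLin_blockDiagonal' {K ι : Type*} [Field K] [Fintype ι]
    [DecidableEq ι] {m n : ι → Type*} [∀ i, Fintype (m i)] [∀ i, Fintype (n i)]
    [∀ i, DecidableEq (n i)] (M : ∀ i, Matrix (m i) (n i) K) :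
    Module.finrank K (LinearMap.ker (blockDiagonal' M).mulVecLin) =
      ∑ i, Module.finrank K (LinearMap.ker (M i).mulVecLin) := by
  have key : ∀ (v : (Σ i, n i) → K) (i : ι) (j : m i),
      (blockDiagonal' M *ᵥ v) ⟨i, j⟩ = (M i *ᵥ fun k => v ⟨i, k⟩) j := by
    intro v i j
    simp only [mulVec, dotProduct, Fintype.sum_sigma]
    rw [Finset.sum_eq_single i]
    · simp
    · intro i' _ h
      exact Finset.sum_eq_zero fun x _ => by
        rw [blockDiagonal'_apply_ne _ _ _ h.symm, zero_mul]
    · simp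
  rw [← Module.finrank_pi_fintype]
  refine LinearEquiv.finrank_eq
    { toFun := fun v i => ⟨fun k => v.1 ⟨i, k⟩, ?_⟩
      invFun := fun w => ⟨fun x => (w x.1).1 x.2, ?_⟩
      map_add' := fun _ _ => rfl
      map_smul' := fun _ _ => rfl
      left_inv := fun _ => rfl
      right_inv := fun _ => rfl }
  · have := v.2
    rw [LinearMap.mem_ker, mulVecLin_apply] at this ⊢
    funext j
    rw [← key, this]
    rfl
  · rw [LinearMap.mem_ker, mulVecLin_apply]
    funext ⟨i, j⟩
    rw [key]
    have := (w i).2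
    rw [LinearMap.mem_ker, mulVecLin_apply] at this
    exact congrFun this j

theorem Matrix.rank_blockDiagonal' {K ι : Type*} [Field K] [Fintype ι]
    [DecidableEq ι] {m n : ι → Type*} [∀ i, Fintype (m i)] [∀ i, Fintype (n i)]
    [∀ i, DecidableEq (n i)] (M : ∀ i, Matrix (m i) (n i) K) :
    (Matrix.blockDiagonal' M).rank = ∑ i, (M i).rank := by
  have h1 := (Matrix.blockDiagonal' M).mulVecLin.finrank_range_add_finrank_ker
  have h2 : ∀ i, (M i).rank + Module.finrank K (LinearMap.ker (M i).mulVecLin) =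
      Fintype.card (n i) := fun i => by
    rw [Matrix.rank, LinearMap.finrank_range_add_finrank_ker,
      Module.finrank_fintype_fun_eq_card]
  rw [Matrix.finrank_ker_mulVecLin_blockDiagonal', Module.finrank_fintype_fun_eq_card,
    Fintype.card_sigma, ← Finset.sum_congr rfl fun i _ => h2 i, Finset.sum_add_distrib] at h1
  exact Nat.add_right_cancel h1

/-- The members `α A + β B`, `(α, β) ≠ 0`, of the pencil all have the same rank. -/
def HasConstantRank {K U V : Type*} [Field K] [AddCommGroup U] [Module K U]
    [AddCommGroup V] [Module K V] (A B : U →ₗ[K] V) : Prop :=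
  ∃ r : ℕ, ∀ α β : K, (α ≠ 0 ∨ β ≠ 0) →
    Module.finrank K (LinearMap.range (α • A + β • B)) = r

namespace PencilBlock

variable {K : Type*} [Field K]

/-- The value of a block at the point `(α, β)`. -/
noncomputable def value (b : PencilBlock K) (α β : K) : Matrix (Fin b.rows) (Fin b.cols) K :=
  α • b.matA + β • b.matB

theorem rank_value_le (b : PencilBlock K) (α β : K) : (b.value α β).rank ≤ min b.rows b.cols :=
  le_min (by simpa using (b.value α β).rank_le_card_height)
    (by simpa using (b.value α β).rank_le_card_width)

-- The columns are independent. For `α ≠ 0` the first `e` rows form a lower triangular system,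
-- solved from the top; for `α = 0` the last `e` rows are `β` times the identity.
open Matrix in
theorem rank_shift (e : ℕ) {α β : K} (h : α ≠ 0 ∨ β ≠ 0) :
    (Matrix.of fun (i : Fin (e + 1)) (j : Fin e) => α * (if (i : ℕ) = j then 1 else 0) +
      β * (if (i : ℕ) = j + 1 then 1 else 0)).rank = e := by
  set M : Matrix (Fin (e + 1)) (Fin e) K := Matrix.of fun (i : Fin (e + 1)) (j : Fin e) =>
    α * (if (i : ℕ) = j then 1 else 0) + β * (if (i : ℕ) = j + 1 then 1 else 0) with hM
  have hinj : LinearMap.ker M.mulVecLin = ⊥ := by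
    rw [LinearMap.ker_eq_bot']
    intro v hv
    have hA : ∀ j : Fin e, (M *ᵥ v) j.castSucc =
        α * v j + β * ∑ k : Fin e, if (j : ℕ) = k + 1 then v k else 0 := by
      intro j
      change ∑ k : Fin e, (α * (if (j : ℕ) = k then 1 else 0) +
        β * (if (j : ℕ) = k + 1 then 1 else 0)) * v k = _
      simp only [add_mul, Finset.sum_add_distrib, Finset.mul_sum]
      congr 1
      · simp [Fin.val_inj]
      · simp
    have hB : ∀ j : Fin e, (M *ᵥ v) j.succ =
        (α * ∑ k : Fin e, if (j : ℕ) + 1 = k then v k else 0) + β * v j := by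
      intro j
      change ∑ k : Fin e, (α * (if (j : ℕ) + 1 = k then 1 else 0) +
        β * (if (j : ℕ) + 1 = k + 1 then 1 else 0)) * v k = _
      simp only [add_mul, Finset.sum_add_distrib, Finset.mul_sum]
      congr 1
      · simp
      · simp [Fin.val_inj]
    rw [Matrix.mulVecLin_apply] at hv
    rw [hv] at hA hB
    have h0 : ∀ n : ℕ, ∀ j : Fin e, (j : ℕ) = n → v j = 0 := by
      intro n
      induction n using Nat.strong_induction_on with
      | _ n ih =>
        intro j hj
        by_cases hα : α = 0
        · have hβ : β ≠ 0 := by tauto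
          simpa [hα, hβ] using hB j
        · have := hA j
          rw [Finset.sum_eq_zero] at this
          · simpa [hα] using this
          · intro k _
            split_ifs with hk
            · exact ih k (by omega) k rfl
            · rfl
    funext j
    exact h0 _ j rfl
  have := M.mulVecLin.finrank_range_add_finrank_ker
  rw [hinj, finrank_bot, Module.finrank_fintype_fun_eq_card, Fintype.card_fin] at this
  exact this

theorem rank_value_vertical (e : ℕ) {α β : K} (h : α ≠ 0 ∨ β ≠ 0) :
    ((vertical e).value α β).rank = e :=
  rank_shift e h

theorem rank_value_horizontal (e : ℕ) {α β : K} (h : α ≠ 0 ∨ β ≠ 0) :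
    ((horizontal e).value α β).rank = e := by
  have hr := rank_shift e h
  rw [← Matrix.rank_transpose] at hr
  have hM : (horizontal e).value α β = (Matrix.of fun (i : Fin (e + 1)) (j : Fin e) =>
      α * (if (i : ℕ) = j then 1 else 0) + β * (if (i : ℕ) = j + 1 then 1 else 0)).transpose := by
    funext i j
    change α * (if (i : ℕ) = j then 1 else 0) + β * (if (i : ℕ) + 1 = j then 1 else 0) =
      α * (if (j : ℕ) = i then 1 else 0) + β * (if (j : ℕ) = i + 1 then 1 else 0)
    simp only [eq_comm]
  rw [hM]
  exact hr

theorem rank_value_of_not_isJordan {b : PencilBlock K} (hb : ¬ b.IsJordan) {α β : K}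
    (h : α ≠ 0 ∨ β ≠ 0) : (b.value α β).rank = min b.rows b.cols := by
  cases b with
  | jordan n ev => exact absurd trivial hb
  | horizontal e =>
    rw [rank_value_horizontal e h]
    exact (min_eq_left e.le_succ).symm
  | vertical e =>
    rw [rank_value_vertical e h]
    exact (min_eq_right e.le_succ).symm

/-- The determinant of the diagonal entry of a Jordan block at `(α, β)`. -/
noncomputable def diagValue (ev : OnePoint K) (α β : K) : K :=
  ev.elim α fun c => α * c + β

/-- The value of a Jordan block as a square matrix. -/
noncomputable def jordanValue (n : ℕ) (ev : OnePoint K) (α β : K) :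
    Matrix (Fin (n + 1)) (Fin (n + 1)) K :=
  (jordan n ev).value α β

theorem jordanValue_apply (n : ℕ) (ev : OnePoint K) (α β : K) (i j : Fin (n + 1)) :
    jordanValue n ev α β i j =
      α * (jordan n ev).entryA i j + β * (jordan n ev).entryB i j :=
  rfl

theorem det_jordanValue (n : ℕ) (ev : OnePoint K) (α β : K) :
    (jordanValue n ev α β).det = diagValue ev α β ^ (n + 1) := by
  have hdiag : ∀ i : Fin (n + 1), jordanValue n ev α β i i = diagValue ev α β := by
    intro i
    rw [jordanValue_apply]
    induction ev using OnePoint.rec <;> simp [entryA, entryB, diagValue]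
  rw [Matrix.det_of_isUpperTriangular]
  · rw [Finset.prod_congr rfl fun i _ => hdiag i]
    simp
  · intro i j hij
    change (j : Fin (n + 1)) < i at hij
    have h1 : (i : ℕ) ≠ j := by have := Fin.lt_def.1 hij; omega
    have h2 : (i : ℕ) + 1 ≠ j := by have := Fin.lt_def.1 hij; omega
    rw [jordanValue_apply]
    induction ev using OnePoint.rec <;> simp [entryA, entryB, h1, h2]

theorem rank_value_jordan (n : ℕ) (ev : OnePoint K) {α β : K} (h : diagValue ev α β ≠ 0) :
    ((jordan n ev).value α β).rank = n + 1 := by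
  have hu : IsUnit (jordanValue n ev α β).det := by
    rw [det_jordanValue]
    exact (pow_ne_zero _ h).isUnit
  have := Matrix.rank_of_isUnit _ ((Matrix.isUnit_iff_isUnit_det _).2 hu)
  rw [Fintype.card_fin] at this
  exact this

theorem rank_value_jordan_lt (n : ℕ) (ev : OnePoint K) {α β : K} (h : diagValue ev α β = 0) :
    ((jordan n ev).value α β).rank < n + 1 := by
  have hd : (jordanValue n ev α β).det = 0 := by
    rw [det_jordanValue, h, zero_pow (by omega)]
  obtain ⟨v, hv, hv0⟩ := Matrix.exists_mulVec_eq_zero_iff.2 hd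
  have h1 := (jordanValue n ev α β).mulVecLin.finrank_range_add_finrank_ker
  have h2 : 0 < Module.finrank K (LinearMap.ker (jordanValue n ev α β).mulVecLin) := by
    rw [Module.finrank_pos_iff_exists_ne_zero]
    exact ⟨⟨v, hv0⟩, fun h => hv (congrArg Subtype.val h)⟩
  rw [Module.finrank_fintype_fun_eq_card, Fintype.card_fin] at h1
  change (jordanValue n ev α β).rank < n + 1
  change (jordanValue n ev α β).rank + _ = n + 1 at h1
  omega

theorem exists_diagValue_eq_zero (ev : OnePoint K) :
    ∃ α β : K, (α ≠ 0 ∨ β ≠ 0) ∧ diagValue ev α β = 0 := by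
  induction ev using OnePoint.rec with
  | infty => exact ⟨0, 1, by simp, rfl⟩
  | coe c => exact ⟨1, -c, by simp, by simp [diagValue]⟩

theorem exists_rank_value_eq [Infinite K] {ι : Type*} [Finite ι] (b : ι → PencilBlock K) :
    ∃ α β : K, (α ≠ 0 ∨ β ≠ 0) ∧
      ∀ i, ((b i).value α β).rank = min (b i).rows (b i).cols := by
  -- At `(1, t)` a finite eigenvalue `c` is hit only for `t = -c`, and the infinite one never. The
  -- default `0` merely excludes one further value of `t`.
  let s : Set K := Set.range fun i => match b i with
    | jordan _ ev => ev.elim 0 fun c => -c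
    | _ => 0
  obtain ⟨t, ht⟩ := (Set.finite_range _ : s.Finite).exists_notMem
  refine ⟨1, t, by simp, fun i => ?_⟩
  by_cases hb : (b i).IsJordan
  · have hi : (match b i with
      | jordan _ ev => ev.elim 0 fun c => -c
      | _ => 0) ≠ t := fun h => ht ⟨i, h⟩
    rcases hbi : b i with ⟨n, ev⟩ | e | e
    · rw [hbi] at hi
      rw [rank_value_jordan]
      · exact (min_self _).symm
      · induction ev using OnePoint.rec with
        | infty => simp [diagValue]
        | coe c =>
          intro h
          simp only [diagValue, OnePoint.elim_some, one_mul] at h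
          exact hi (by simpa using neg_eq_of_add_eq_zero_right h)
    · exact absurd hb (by simp [hbi, IsJordan])
    · exact absurd hb (by simp [hbi, IsJordan])
  · exact rank_value_of_not_isJordan hb (by simp)

end PencilBlock

section KroneckerFormRank

variable {K U V : Type*} [Field K] [AddCommGroup U] [Module K U] [AddCommGroup V] [Module K V]
  {A B : U →ₗ[K] V} {k : ℕ} {b : Fin k → PencilBlock K}

theorem IsKroneckerForm.finrank_range (h : IsKroneckerForm A B b) (α β : K) :
    Module.finrank K (LinearMap.range (α • A + β • B)) = ∑ i, ((b i).value α β).rank := by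
  obtain ⟨bU, bV, hA, hB⟩ := h
  rw [← Matrix.rank_blockDiagonal']
  have hM : LinearMap.toMatrix bU bV (α • A + β • B) =
      Matrix.blockDiagonal' fun i => (b i).value α β := by
    rw [map_add, map_smul, map_smul, hA, hB, ← Matrix.blockDiagonal'_smul,
      ← Matrix.blockDiagonal'_smul, ← Matrix.blockDiagonal'_add]
    rfl
  rw [← hM, Matrix.rank_eq_finrank_range_toLin _ bV bU, Matrix.toLin_toMatrix]

theorem HasNoJordanBlocks.hasConstantRank (h : HasNoJordanBlocks A B) : HasConstantRank A B := by
  obtain ⟨k, b, hb, hJ⟩ := h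
  refine ⟨∑ i, min (b i).rows (b i).cols, fun α β h => ?_⟩
  rw [hb.finrank_range]
  exact Finset.sum_congr rfl fun i _ => PencilBlock.rank_value_of_not_isJordan (hJ i) h

/-- Compare a point where every block has full rank with the eigenvalue of a supposed Jordan block:
there that block loses rank and no other block can compensate. The conclusion covers every canonical
form of the pencil, so uniqueness of the form is never needed. -/
theorem HasConstantRank.not_isJordan [Infinite K] (h : HasConstantRank A B)
    (hb : IsKroneckerForm A B b) (i : Fin k) : ¬ (b i).IsJordan := by
  intro hi
  obtain ⟨r, hr⟩ := h
  obtain ⟨α, β, h0, hgen⟩ := PencilBlock.exists_rank_value_eq b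
  rcases hbi : b i with ⟨n, ev⟩ | e | e
  · obtain ⟨α', β', h0', hd⟩ := PencilBlock.exists_diagValue_eq_zero ev
    have h1 := hr α β h0
    have h2 := hr α' β' h0'
    rw [hb.finrank_range, Finset.sum_congr rfl fun i _ => hgen i] at h1
    rw [hb.finrank_range, ← h1] at h2
    refine absurd h2 (Finset.sum_lt_sum (fun j _ => (b j).rank_value_le _ _)
      ⟨i, Finset.mem_univ i, ?_⟩).ne
    rw [hbi]
    exact (PencilBlock.rank_value_jordan_lt n ev hd).trans_eq (min_self _).symm
  · exact absurd hi (by simp [hbi, PencilBlock.IsJordan])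
  · exact absurd hi (by simp [hbi, PencilBlock.IsJordan])

end KroneckerFormRank

/-! ### Injective pencils are sums of vertical blocks -/

open Module in
/-- The pencil `A + t B` is a direct sum of vertical Kronecker blocks. -/
def IsVerticalSum {K U V : Type*} [Field K] [AddCommGroup U] [Module K U]
    [AddCommGroup V] [Module K V] (A B : U →ₗ[K] V) : Prop :=
  ∃ (ι : Type) (_ : Finite ι) (e : ι → ℕ) (g : Basis (Σ i, Fin (e i)) K U)
    (h : Basis (Σ i, Fin (e i + 1)) K V),
    ∀ i j, A (g ⟨i, j⟩) = h ⟨i, j.castSucc⟩ ∧ B (g ⟨i, j⟩) = h ⟨i, j.succ⟩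

/-- All nonzero members of the pencil are injective. -/
def IsInjectivePencil {K U V : Type*} [Field K] [AddCommGroup U] [Module K U]
    [AddCommGroup V] [Module K V] (A B : U →ₗ[K] V) : Prop :=
  ∀ α β : K, (α ≠ 0 ∨ β ≠ 0) → ∀ u, α • A u + β • B u = 0 → u = 0

section Reflection

variable {K U V : Type*} [Field K] [AddCommGroup U] [Module K U] [AddCommGroup V] [Module K V]

/-- The map `(s, t) ↦ A t - B s`. -/
def syzygyMap (A B : U →ₗ[K] V) : U × U →ₗ[K] V :=
  A ∘ₗ LinearMap.snd K U U - B ∘ₗ LinearMap.fst K U U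

theorem syzygyMap_apply (A B : U →ₗ[K] V) (p : U × U) : syzygyMap A B p = A p.2 - B p.1 :=
  rfl

/-- The first map of the reflected pencil. -/
def syzygyFst (A B : U →ₗ[K] V) : LinearMap.ker (syzygyMap A B) →ₗ[K] U :=
  LinearMap.fst K U U ∘ₗ Submodule.subtype _

/-- The second map of the reflected pencil. -/
def syzygySnd (A B : U →ₗ[K] V) : LinearMap.ker (syzygyMap A B) →ₗ[K] U :=
  LinearMap.snd K U U ∘ₗ Submodule.subtype _

theorem apply_syzygySnd (A B : U →ₗ[K] V) (p : LinearMap.ker (syzygyMap A B)) :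
    A (syzygySnd A B p) = B (syzygyFst A B p) :=
  sub_eq_zero.1 p.2

/-- Apply `A` and `B` to `α s + β t = 0`. Since `A t = B s`, the results are the member `α A + β B`
evaluated at `s` and at `t`. -/
theorem IsInjectivePencil.syzygy {A B : U →ₗ[K] V} (h : IsInjectivePencil A B) :
    IsInjectivePencil (syzygyFst A B) (syzygySnd A B) := by
  rintro α β h0 p hp
  have hA := congrArg A hp
  have hB := congrArg B hp
  simp only [map_add, map_smul, map_zero, apply_syzygySnd] at hA hB
  have h1 : syzygyFst A B p = 0 := h α β h0 _ hA
  have h2 : syzygySnd A B p = 0 := h α β h0 _ (by rw [apply_syzygySnd]; exact hB)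
  exact Subtype.ext (Prod.ext h1 h2)

open Module

/-- A chain `g 0, …, g e` of the reflected pencil satisfies `A (g (j + 1)) = B (g j)`, so `A (g 0),
B (g 0), …, B (g e)` is a chain one longer. These vectors span `range A + range B`, and a dimension
count makes them a basis of it. -/
theorem IsVerticalSum.of_syzygy [FiniteDimensional K U] [FiniteDimensional K V]
    {A B : U →ₗ[K] V} (h : IsVerticalSum (syzygyFst A B) (syzygySnd A B)) :
    IsVerticalSum A B := by
  obtain ⟨ι, _, e, f, g, hfg⟩ := h
  have := Fintype.ofFinite ι
  let V₀ := LinearMap.range (syzygyMap A B)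
  have memA : ∀ u, A u ∈ V₀ := fun u => ⟨(0, u), by simp [syzygyMap_apply]⟩
  have memB : ∀ u, B u ∈ V₀ := fun u => ⟨(-u, 0), by simp [syzygyMap_apply]⟩
  let w : (Σ i, Fin (e i + 2)) → V₀ := fun x =>
    Fin.cases (motive := fun _ => V₀) ⟨A (g ⟨x.1, 0⟩), memA _⟩
      (fun j => ⟨B (g ⟨x.1, j⟩), memB _⟩) x.2
  have hwB : ∀ i (j : Fin (e i + 1)), (w ⟨i, j.succ⟩ : V) = B (g ⟨i, j⟩) := fun i j => rfl
  have hwA : ∀ i (j : Fin (e i + 1)), (w ⟨i, j.castSucc⟩ : V) = A (g ⟨i, j⟩) := by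
    intro i j
    induction j using Fin.cases with
    | zero => rfl
    | succ j =>
      rw [← Fin.succ_castSucc, hwB, ← (hfg i j).1, ← (hfg i j).2, apply_syzygySnd]
  have hspan : ⊤ ≤ Submodule.span K (Set.range w) := by
    have h1 : V₀ ≤ (Submodule.span K (Set.range w)).map V₀.subtype := by
      rintro _ ⟨⟨s, t⟩, rfl⟩
      rw [syzygyMap_apply]
      have key : ∀ (T : U →ₗ[K] V), (∀ x, T (g x) ∈ (Submodule.span K (Set.range w)).map V₀.subtype)
          → ∀ u, T u ∈ (Submodule.span K (Set.range w)).map V₀.subtype := by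
        intro T hT u
        rw [← g.sum_repr u, map_sum]
        refine Submodule.sum_mem _ fun x _ => ?_
        rw [map_smul]
        exact Submodule.smul_mem _ _ (hT x)
      refine Submodule.sub_mem _ (key A ?_ t) (key B ?_ s)
      · rintro ⟨i, j⟩
        exact ⟨_, Submodule.subset_span ⟨⟨i, j.castSucc⟩, rfl⟩, hwA i j⟩
      · rintro ⟨i, j⟩
        exact ⟨_, Submodule.subset_span ⟨⟨i, j.succ⟩, rfl⟩, hwB i j⟩
    intro x _
    obtain ⟨y, hy, hyx⟩ := h1 x.2
    rwa [← Subtype.ext (a1 := y) (a2 := x) hyx]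
  have hcard : Fintype.card (Σ i, Fin (e i + 2)) = finrank K V₀ := by
    have h1 := (syzygyMap A B).finrank_range_add_finrank_ker
    have h2 := finrank_eq_card_basis f
    have h3 := finrank_eq_card_basis g
    rw [h2, finrank_prod, h3] at h1
    simp only [Fintype.card_sigma, Fintype.card_fin, Finset.sum_add_distrib] at h1 ⊢
    change finrank K V₀ + _ = _ at h1
    simp only [Finset.sum_const, smul_eq_mul] at h1 ⊢
    omega
  let b : Basis (Σ i, Fin (e i + 2)) K V₀ := basisOfTopLeSpanOfCardEqFinrank w hspan hcard
  have hb : ∀ x, b x = w x := fun x => by simp [b]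
  -- A complement of `range A + range B` contributes vertical blocks without columns.
  let κ := Fin (finrank K (V ⧸ V₀))
  let e' : ι ⊕ κ → ℕ := Sum.elim (fun i => e i + 1) fun _ => 0
  have : IsEmpty (Σ _ : κ, Fin 0) := ⟨fun x => x.2.elim0⟩
  let eU : (Σ i, Fin (e i + 1)) ≃ Σ i, Fin (e' i) :=
    (Equiv.sumEmpty _ (Σ _ : κ, Fin 0)).symm.trans
      (Equiv.sumSigmaDistrib fun i : ι ⊕ κ => Fin (e' i)).symm
  let eV : (Σ i, Fin (e i + 2)) ⊕ κ ≃ Σ i, Fin (e' i + 1) :=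
    (Equiv.sumCongr (Equiv.refl _) (Equiv.sigmaUnique κ fun _ => Fin 1).symm).trans
      (Equiv.sumSigmaDistrib fun i : ι ⊕ κ => Fin (e' i + 1)).symm
  refine ⟨ι ⊕ κ, inferInstance, e', g.reindex eU,
    (b.sumQuot (finBasis K (V ⧸ V₀))).reindex eV, ?_⟩
  rintro (i | k) j
  · have h1 : eU ⟨i, j⟩ = ⟨Sum.inl i, j⟩ := rfl
    have h2 : eV (Sum.inl ⟨i, j.castSucc⟩) = ⟨Sum.inl i, j.castSucc⟩ := rfl
    have h3 : eV (Sum.inl ⟨i, j.succ⟩) = ⟨Sum.inl i, j.succ⟩ := rfl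
    rw [← h1, ← h2, ← h3]
    simp only [Basis.reindex_apply, Equiv.symm_apply_apply, Basis.sumQuot_inl, hb]
    exact ⟨(hwA i j).symm, (hwB i j).symm⟩
  · exact Fin.elim0 j

theorem IsVerticalSum.of_finrank_eq_zero [FiniteDimensional K U] [FiniteDimensional K V]
    (A B : U →ₗ[K] V) (h : finrank K U = 0) : IsVerticalSum A B := by
  have := finrank_zero_iff.1 h
  let κ := Fin (finrank K V)
  have : IsEmpty (Σ _ : κ, Fin 0) := ⟨fun x => x.2.elim0⟩
  exact ⟨κ, inferInstance, fun _ => 0, Basis.empty U,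
    (finBasis K V).reindex (Equiv.sigmaUnique κ fun _ => Fin 1).symm, fun i j => Fin.elim0 j⟩

/-- Otherwise `range A + range B` has dimension at most `dim U`, so it equals `range A`. Then `A⁻¹
B` is an endomorphism of `U`, and an eigenvector lies in the kernel of some `B - c A`. -/
theorem IsInjectivePencil.finrank_ker_lt [IsAlgClosed K] [FiniteDimensional K U]
    [FiniteDimensional K V] {A B : U →ₗ[K] V} (h : IsInjectivePencil A B)
    (hU : finrank K U ≠ 0) : finrank K (LinearMap.ker (syzygyMap A B)) < finrank K U := by
  by_contra! hlt
  have hA : Function.Injective A := by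
    rw [← LinearMap.ker_eq_bot, LinearMap.ker_eq_bot']
    exact fun u hu => h 1 0 (by simp) u (by simp [hu])
  have h1 := (syzygyMap A B).finrank_range_add_finrank_ker
  rw [finrank_prod] at h1
  have h2 : LinearMap.range A ≤ LinearMap.range (syzygyMap A B) := by
    rintro _ ⟨u, rfl⟩
    exact ⟨(0, u), by simp [syzygyMap_apply]⟩
  have h3 := LinearMap.finrank_range_of_inj hA
  have h4 : LinearMap.range A = LinearMap.range (syzygyMap A B) :=
    Submodule.eq_of_le_of_finrank_le h2 (by omega)
  have hB : ∀ u, B u ∈ LinearMap.range A := fun u => by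
    rw [h4]
    exact ⟨(-u, 0), by simp [syzygyMap_apply]⟩
  let T : End K U := (LinearEquiv.ofInjective A hA).symm.toLinearMap ∘ₗ B.codRestrict _ hB
  have hT : ∀ u, A (T u) = B u := fun u => by
    have := (LinearEquiv.ofInjective A hA).apply_symm_apply (B.codRestrict _ hB u)
    exact congrArg Subtype.val this
  have : Nontrivial U := nontrivial_of_finrank_pos (Nat.pos_of_ne_zero hU)
  obtain ⟨c, hc⟩ := End.exists_eigenvalue T
  obtain ⟨x, hx⟩ := hc.exists_hasEigenvector
  refine hx.2 (h (-c) 1 (by simp) x ?_)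
  rw [← hT, hx.apply_eq_smul]
  simp

end Reflection

theorem IsInjectivePencil.isVerticalSum_aux.{u, v} {K : Type v} [Field K] [IsAlgClosed K] (n : ℕ) :
    ∀ {U V : Type u} [AddCommGroup U] [Module K U] [AddCommGroup V] [Module K V]
      [FiniteDimensional K U] [FiniteDimensional K V] {A B : U →ₗ[K] V},
      Module.finrank K U = n → IsInjectivePencil A B → IsVerticalSum A B := by
  induction n using Nat.strong_induction_on with
  | _ n ih =>
    intro U V _ _ _ _ _ _ A B hn h
    by_cases h0 : Module.finrank K U = 0
    · exact IsVerticalSum.of_finrank_eq_zero A B h0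
    · exact IsVerticalSum.of_syzygy (ih _ (hn ▸ h.finrank_ker_lt h0) rfl h.syzygy)

/-- The induction needs both spaces in one universe. One preliminary reflection achieves this, since
the reflected pencil involves only `U × U` and `U`. -/
theorem IsInjectivePencil.isVerticalSum {K U V : Type*} [Field K] [IsAlgClosed K]
    [AddCommGroup U] [Module K U] [AddCommGroup V] [Module K V] [FiniteDimensional K U]
    [FiniteDimensional K V] {A B : U →ₗ[K] V} (h : IsInjectivePencil A B) :
    IsVerticalSum A B :=
  IsVerticalSum.of_syzygy (IsInjectivePencil.isVerticalSum_aux _ rfl h.syzygy)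

section

open Module

/-! ### Block forms under isomorphism, direct sum and duality -/

section PencilForm

variable {K U V U' V' : Type*} [Field K] [AddCommGroup U] [Module K U] [AddCommGroup V]
  [Module K V] [AddCommGroup U'] [Module K U'] [AddCommGroup V'] [Module K V']

/-- Kronecker form with blocks indexed by an arbitrary type, in terms of the action on bases. -/
def IsPencilForm (A B : U →ₗ[K] V) {ι : Type} (b : ι → PencilBlock K) : Prop :=
  ∃ (bU : Basis (Σ i, Fin (b i).cols) K U) (bV : Basis (Σ i, Fin (b i).rows) K V),
    ∀ i j, A (bU ⟨i, j⟩) = ∑ l, (b i).matA l j • bV ⟨i, l⟩ ∧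
      B (bU ⟨i, j⟩) = ∑ l, (b i).matB l j • bV ⟨i, l⟩

theorem toMatrix_eq_blockDiagonal' {ι : Type} [Fintype ι] [DecidableEq ι] {m n : ι → ℕ}
    (bU : Basis (Σ i, Fin (n i)) K U) (bV : Basis (Σ i, Fin (m i)) K V) (A : U →ₗ[K] V)
    (M : ∀ i, Matrix (Fin (m i)) (Fin (n i)) K)
    (h : ∀ i j, A (bU ⟨i, j⟩) = ∑ l, M i l j • bV ⟨i, l⟩) :
    LinearMap.toMatrix bU bV A = Matrix.blockDiagonal' M := by
  ext ⟨i', l⟩ ⟨i, j⟩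
  rw [LinearMap.toMatrix_apply, h, map_sum, Finset.sum_apply']
  simp only [map_smul, Basis.repr_self, Finsupp.smul_apply, smul_eq_mul]
  by_cases hi : i' = i
  · subst hi
    rw [Matrix.blockDiagonal'_apply_eq, Finset.sum_eq_single l]
    · simp
    · intro l' _ hl
      rw [Finsupp.single_eq_of_ne, mul_zero]
      simpa using hl.symm
    · simp
  · rw [Matrix.blockDiagonal'_apply_ne _ _ _ hi]
    refine Finset.sum_eq_zero fun l' _ => ?_
    rw [Finsupp.single_eq_of_ne, mul_zero]
    exact fun h => hi (congrArg Sigma.fst h)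

theorem IsPencilForm.exists_isKroneckerForm {A B : U →ₗ[K] V} {ι : Type} [Finite ι]
    {b : ι → PencilBlock K} (h : IsPencilForm A B b) :
    ∃ (k : ℕ) (σ : Fin k → ι), IsKroneckerForm A B fun i => b (σ i) := by
  obtain ⟨bU, bV, h⟩ := h
  have := Fintype.ofFinite ι
  let σ := (Fintype.equivFin ι).symm
  refine ⟨_, σ, bU.reindex (Equiv.sigmaCongrLeft (β := fun i => Fin (b i).cols) σ).symm,
    bV.reindex (Equiv.sigmaCongrLeft (β := fun i => Fin (b i).rows) σ).symm,
    toMatrix_eq_blockDiagonal' _ _ _ _ fun i j => ?_,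
    toMatrix_eq_blockDiagonal' _ _ _ _ fun i j => ?_⟩
  · simpa using (h (σ i) j).1
  · simpa using (h (σ i) j).2

theorem IsPencilForm.map {A B : U →ₗ[K] V} {A' B' : U' →ₗ[K] V'} {ι : Type}
    {b : ι → PencilBlock K} (h : IsPencilForm A B b) (eU : U ≃ₗ[K] U') (eV : V ≃ₗ[K] V')
    (hA : ∀ u, A' (eU u) = eV (A u)) (hB : ∀ u, B' (eU u) = eV (B u)) :
    IsPencilForm A' B' b := by
  obtain ⟨bU, bV, h⟩ := h
  refine ⟨bU.map eU, bV.map eV, fun i j => ⟨?_, ?_⟩⟩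
  · simp [hA, (h i j).1]
  · simp [hB, (h i j).2]

theorem IsPencilForm.prodMap {A B : U →ₗ[K] V} {A' B' : U' →ₗ[K] V'} {ι ι' : Type}
    {b : ι → PencilBlock K} {b' : ι' → PencilBlock K} (h : IsPencilForm A B b)
    (h' : IsPencilForm A' B' b') :
    IsPencilForm (A.prodMap A') (B.prodMap B') (Sum.elim b b') := by
  obtain ⟨bU, bV, h⟩ := h
  obtain ⟨bU', bV', h'⟩ := h'
  let eU : (Σ i, Fin (b i).cols) ⊕ (Σ i, Fin (b' i).cols) ≃ Σ s, Fin (Sum.elim b b' s).cols :=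
    (Equiv.sumSigmaDistrib fun s => Fin (Sum.elim b b' s).cols).symm
  let eV : (Σ i, Fin (b i).rows) ⊕ (Σ i, Fin (b' i).rows) ≃ Σ s, Fin (Sum.elim b b' s).rows :=
    (Equiv.sumSigmaDistrib fun s => Fin (Sum.elim b b' s).rows).symm
  let cU := (bU.prod bU').reindex eU
  let cV := (bV.prod bV').reindex eV
  have hU1 : ∀ i j, cU ⟨Sum.inl i, j⟩ = (bU ⟨i, j⟩, 0) := fun i j => by
    change (bU.prod bU').reindex eU (eU (Sum.inl ⟨i, j⟩)) = _
    simp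
  have hU2 : ∀ i j, cU ⟨Sum.inr i, j⟩ = (0, bU' ⟨i, j⟩) := fun i j => by
    change (bU.prod bU').reindex eU (eU (Sum.inr ⟨i, j⟩)) = _
    simp
  have hV1 : ∀ i j, cV ⟨Sum.inl i, j⟩ = (bV ⟨i, j⟩, 0) := fun i j => by
    change (bV.prod bV').reindex eV (eV (Sum.inl ⟨i, j⟩)) = _
    simp
  have hV2 : ∀ i j, cV ⟨Sum.inr i, j⟩ = (0, bV' ⟨i, j⟩) := fun i j => by
    change (bV.prod bV').reindex eV (eV (Sum.inr ⟨i, j⟩)) = _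
    simp
  refine ⟨cU, cV, ?_⟩
  rintro (i | i) j
  · rw [hU1]
    simp only [hV1, LinearMap.prodMap_apply, map_zero, (h i j).1, (h i j).2, Prod.ext_iff,
      Prod.fst_sum, Prod.snd_sum, Prod.smul_mk, smul_zero, Finset.sum_const_zero]
    exact ⟨⟨rfl, trivial⟩, rfl, trivial⟩
  · rw [hU2]
    simp only [hV2, LinearMap.prodMap_apply, map_zero, (h' i j).1, (h' i j).2, Prod.ext_iff,
      Prod.fst_sum, Prod.snd_sum, Prod.smul_mk, smul_zero, Finset.sum_const_zero]
    exact ⟨⟨trivial, rfl⟩, trivial, rfl⟩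

theorem IsVerticalSum.exists_isPencilForm {A B : U →ₗ[K] V} (h : IsVerticalSum A B) :
    ∃ (ι : Type) (_ : Finite ι) (e : ι → ℕ),
      IsPencilForm A B fun i => PencilBlock.vertical (e i) := by
  obtain ⟨ι, hι, e, g, h, hgh⟩ := h
  have key : ∀ i (j : Fin (e i)),
      A (g ⟨i, j⟩) = ∑ l : Fin (e i + 1), (if (l : ℕ) = j then (1 : K) else 0) • h ⟨i, l⟩ ∧
      B (g ⟨i, j⟩) = ∑ l : Fin (e i + 1), (if (l : ℕ) = j + 1 then (1 : K) else 0) • h ⟨i, l⟩ := by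
    intro i j
    rw [(hgh i j).1, (hgh i j).2, Finset.sum_eq_single j.castSucc, Finset.sum_eq_single j.succ]
    · simp
    · intro l _ hl
      rw [if_neg, zero_smul]
      exact fun h => hl (Fin.ext h)
    · simp
    · intro l _ hl
      rw [if_neg, zero_smul]
      exact fun h => hl (Fin.ext h)
    · simp
  exact ⟨ι, hι, e, g, h, key⟩

section Dual

variable [FiniteDimensional K U]

theorem Module.Basis.apply_evalEquiv_symm_dualBasis {κ : Type*} [Finite κ] [DecidableEq κ]
    (h : Basis κ K (Dual K U)) (x y : κ) :
    h x ((h.dualBasis.map (evalEquiv K U).symm) y) = if x = y then 1 else 0 := by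
  rw [Basis.map_apply, apply_evalEquiv_symm_apply, Basis.dualBasis_apply_self]

theorem Module.Basis.eq_of_dual_apply_eq {κ : Type*} (h : Basis κ K (Dual K U)) {u v : U}
    (huv : ∀ x, h x u = h x v) : u = v := by
  refine (evalEquiv K U).injective (h.ext fun x => ?_)
  simpa using huv x

end Dual

/-- Pairing with the functionals `g` shows that the matrix of `T` is the transpose of that of its
dual. This is what turns vertical blocks into horizontal ones. -/
theorem apply_dualBasis_of_dualMap [FiniteDimensional K U] [FiniteDimensional K V]
    {ι : Type*} [Finite ι] [DecidableEq ι] {m n : ι → ℕ} {T : U →ₗ[K] V}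
    (g : Basis (Σ i, Fin (m i)) K (Dual K V)) (h : Basis (Σ i, Fin (n i)) K (Dual K U))
    (s : ∀ i, Fin (m i) → Fin (n i)) (hT : ∀ i j, T.dualMap (g ⟨i, j⟩) = h ⟨i, s i j⟩)
    (i : ι) (j : Fin (n i)) :
    T ((h.dualBasis.map (evalEquiv K U).symm) ⟨i, j⟩) =
      ∑ l, (if s i l = j then (1 : K) else 0) •
        (g.dualBasis.map (evalEquiv K V).symm) ⟨i, l⟩ := by
  refine g.eq_of_dual_apply_eq fun ⟨k, l⟩ => ?_
  rw [← LinearMap.dualMap_apply, hT, map_sum]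
  simp only [map_smul, Basis.apply_evalEquiv_symm_dualBasis, smul_eq_mul]
  by_cases hk : k = i
  · subst hk
    simp
  · rw [if_neg fun h => hk (congrArg Sigma.fst h)]
    exact (Finset.sum_eq_zero fun l' _ => by
      rw [if_neg fun h => hk (congrArg Sigma.fst h), mul_zero]).symm

theorem IsVerticalSum.exists_isPencilForm_of_dual [FiniteDimensional K U]
    [FiniteDimensional K V] {A B : U →ₗ[K] V} (h : IsVerticalSum A.dualMap B.dualMap) :
    ∃ (ι : Type) (_ : Finite ι) (e : ι → ℕ),
      IsPencilForm A B fun i => PencilBlock.horizontal (e i) := by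
  classical
  obtain ⟨ι, hι, e, g, h, hgh⟩ := h
  have key : ∀ i (j : Fin (e i + 1)),
      A ((h.dualBasis.map (evalEquiv K U).symm) ⟨i, j⟩) =
        ∑ l : Fin (e i), (if (l : ℕ) = j then (1 : K) else 0) •
          (g.dualBasis.map (evalEquiv K V).symm) ⟨i, l⟩ ∧
      B ((h.dualBasis.map (evalEquiv K U).symm) ⟨i, j⟩) =
        ∑ l : Fin (e i), (if (l : ℕ) + 1 = j then (1 : K) else 0) •
          (g.dualBasis.map (evalEquiv K V).symm) ⟨i, l⟩ := by
    intro i j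
    rw [apply_dualBasis_of_dualMap g h (fun _ => Fin.castSucc) (fun i j => (hgh i j).1),
      apply_dualBasis_of_dualMap g h (fun _ => Fin.succ) (fun i j => (hgh i j).2)]
    simp only [Fin.ext_iff, Fin.val_castSucc, Fin.val_succ]
    exact ⟨trivial, trivial⟩
  exact ⟨ι, hι, e, _, _, key⟩

end PencilForm

/-! ### Splitting off a surjective subpencil -/

section Splitting

variable {K U V : Type*} [Field K] [AddCommGroup U] [Module K U] [AddCommGroup V] [Module K V]

/-- A chain modulo `(P, N)` is corrected from left to right. The error of `A (g j)` lies in `N`,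
hence is `A p` with `p ∈ P`; subtracting `p` from `g j` moves the next vector `B (g j)` only within
`N`. -/
theorem exists_chain_lift {A B : U →ₗ[K] V} {P : Submodule K U} {N : Submodule K V}
    (hA : N ≤ P.map A) (hB : P ≤ N.comap B) :
    ∀ (e : ℕ) (g : Fin e → U) (h : Fin (e + 1) → V),
      (∀ j, A (g j) - h j.castSucc ∈ N ∧ B (g j) - h j.succ ∈ N) →
      ∃ (g' : Fin e → U) (h' : Fin (e + 1) → V), (∀ j, g' j - g j ∈ P) ∧ (∀ j, h' j - h j ∈ N) ∧
        ∀ j, A (g' j) = h' j.castSucc ∧ B (g' j) = h' j.succ := by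
  intro e
  induction e with
  | zero => exact fun g h _ => ⟨g, h, fun j => j.elim0, fun j => by simp, fun j => j.elim0⟩
  | succ e ih =>
    intro g h hgh
    obtain ⟨g', h', hg', hh', hr⟩ := ih (fun j => g j.castSucc) (fun j => h j.castSucc)
      fun j => ⟨(hgh j.castSucc).1, (hgh j.castSucc).2⟩
    obtain ⟨p, hp, hpA⟩ : A (g (Fin.last e)) - h' (Fin.last e) ∈ P.map A := by
      refine hA ?_
      have := N.sub_mem (hgh (Fin.last e)).1 (hh' (Fin.last e))
      rwa [sub_sub, add_sub_cancel] at this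
    refine ⟨Fin.snoc (α := fun _ => U) g' (g (Fin.last e) - p),
      Fin.snoc (α := fun _ => V) h' (B (g (Fin.last e) - p)), fun j => ?_, fun j => ?_,
      fun j => ?_⟩
    · induction j using Fin.lastCases with
      | last => simpa using hp
      | cast j => simpa using hg' j
    · induction j using Fin.lastCases with
      | last =>
        rw [Fin.snoc_last, map_sub, sub_right_comm]
        exact N.sub_mem (hgh (Fin.last e)).2 (hB hp)
      | cast j => simpa using hh' j
    · induction j using Fin.lastCases with
      | last =>
        rw [Fin.snoc_last, Fin.snoc_castSucc, Fin.succ_last, Fin.snoc_last, map_sub, hpA]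
        simp
      | cast j =>
        rw [Fin.snoc_castSucc, Fin.snoc_castSucc, Fin.succ_castSucc, Fin.snoc_castSucc]
        exact hr j

theorem Submodule.bijective_subtype_coprod (Q : Submodule K U) {t : U ⧸ Q →ₗ[K] U}
    (ht : ∀ q, Q.mkQ (t q) = q) : Function.Bijective (Q.subtype.coprod t) := by
  constructor
  · rw [← LinearMap.ker_eq_bot, LinearMap.ker_eq_bot']
    rintro ⟨p, q⟩ hpq
    rw [LinearMap.coprod_apply] at hpq
    have hp : Q.mkQ p = 0 := by simp
    have hq : q = 0 := by
      have := congrArg Q.mkQ hpq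
      rwa [map_add, ht, map_zero, Submodule.subtype_apply, hp, zero_add] at this
    subst hq
    simpa using hpq
  · intro w
    have hw : w - t (Q.mkQ w) ∈ LinearMap.ker Q.mkQ := by
      rw [LinearMap.mem_ker, map_sub, ht, sub_self]
    rw [Q.ker_mkQ] at hw
    exact ⟨(⟨_, hw⟩, Q.mkQ w), by simp⟩

/-- All nonzero members of the pencil map `P` onto `N`. -/
def IsSurjectiveOn (A B : U →ₗ[K] V) (P : Submodule K U) (N : Submodule K V) : Prop :=
  ∀ α β : K, (α ≠ 0 ∨ β ≠ 0) → P.map (α • A + β • B) = N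

namespace IsSurjectiveOn

variable {A B : U →ₗ[K] V} {P : Submodule K U} {N : Submodule K V}

theorem map_left (h : IsSurjectiveOn A B P N) : P.map A = N := by
  have := h 1 0 (Or.inl one_ne_zero)
  rwa [one_smul, zero_smul, add_zero] at this

theorem map_right (h : IsSurjectiveOn A B P N) : P.map B = N := by
  have := h 0 1 (Or.inr one_ne_zero)
  rwa [one_smul, zero_smul, zero_add] at this

theorem le_comap_left (h : IsSurjectiveOn A B P N) : P ≤ N.comap A :=
  Submodule.map_le_iff_le_comap.1 h.map_left.le

theorem le_comap_right (h : IsSurjectiveOn A B P N) : P ≤ N.comap B :=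
  Submodule.map_le_iff_le_comap.1 h.map_right.le

/-- A functional on `N` killed by the dual of a nonzero member vanishes on the image of `P`, which
is all of `N`. -/
theorem isInjectivePencil_dualMap (h : IsSurjectiveOn A B P N) :
    IsInjectivePencil (A.restrict h.le_comap_left).dualMap (B.restrict h.le_comap_right).dualMap := by
  intro α β h0 φ hφ
  ext ⟨y, hy⟩
  rw [← h α β h0] at hy
  obtain ⟨x, hx, rfl⟩ := hy
  have hx' : φ (α • (A.restrict h.le_comap_left ⟨x, hx⟩) +
      β • (B.restrict h.le_comap_right ⟨x, hx⟩)) = 0 := by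
    rw [map_add, map_smul, map_smul]
    exact LinearMap.congr_fun hφ ⟨x, hx⟩
  exact hx'

theorem exists_isPencilForm [FiniteDimensional K U] [FiniteDimensional K V] [IsAlgClosed K]
    (h : IsSurjectiveOn A B P N) : ∃ (ι : Type) (_ : Finite ι) (e : ι → ℕ),
      IsPencilForm (A.restrict h.le_comap_left) (B.restrict h.le_comap_right)
        fun i => PencilBlock.horizontal (e i) :=
  h.isInjectivePencil_dualMap.isVerticalSum.exists_isPencilForm_of_dual

/-- The lifted chains define sections of both quotient maps which commute with `A` and `B`, so the
pencil is the direct sum of its restriction and its quotient. -/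
theorem isPencilForm_of_quotient (h : IsSurjectiveOn A B P N) {ι ι' : Type}
    {b : ι → PencilBlock K} {b' : ι' → PencilBlock K}
    (hb : IsPencilForm (A.restrict h.le_comap_left) (B.restrict h.le_comap_right) b)
    (hb' : IsPencilForm (P.mapQ N A h.le_comap_left) (P.mapQ N B h.le_comap_right) b')
    (hv : IsVerticalSum (P.mapQ N A h.le_comap_left) (P.mapQ N B h.le_comap_right)) :
    IsPencilForm A B (Sum.elim b b') := by
  obtain ⟨κ, _, e, f, f', hf⟩ := hv
  choose g hg using fun x => P.mkQ_surjective (f x)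
  choose g' hg' using fun x => N.mkQ_surjective (f' x)
  have key : ∀ i, _ := fun i => exists_chain_lift h.map_left.ge h.le_comap_right (e i)
    (fun j => g ⟨i, j⟩) (fun j => g' ⟨i, j⟩) fun j => by
      rw [← N.ker_mkQ, LinearMap.mem_ker, LinearMap.mem_ker, map_sub, map_sub, hg', hg',
        ← (hf i j).1, ← (hf i j).2, ← hg]
      simp
  choose s s' hs hs' hss using key
  let sU : U ⧸ P →ₗ[K] U := f.constr K fun x => s x.1 x.2
  let sV : V ⧸ N →ₗ[K] V := f'.constr K fun x => s' x.1 x.2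
  have hsU : ∀ q, P.mkQ (sU q) = q := by
    refine LinearMap.congr_fun (f := P.mkQ ∘ₗ sU) (g := LinearMap.id) (f.ext fun x => ?_)
    rw [LinearMap.comp_apply, LinearMap.id_apply, Basis.constr_basis, ← hg, ← sub_eq_zero,
      ← map_sub, ← LinearMap.mem_ker, P.ker_mkQ]
    exact hs _ _
  have hsV : ∀ q, N.mkQ (sV q) = q := by
    refine LinearMap.congr_fun (f := N.mkQ ∘ₗ sV) (g := LinearMap.id) (f'.ext fun x => ?_)
    rw [LinearMap.comp_apply, LinearMap.id_apply, Basis.constr_basis, ← hg', ← sub_eq_zero,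
      ← map_sub, ← LinearMap.mem_ker, N.ker_mkQ]
    exact hs' _ _
  have hsA : ∀ q, A (sU q) = sV (P.mapQ N A h.le_comap_left q) := by
    refine LinearMap.congr_fun (f := A ∘ₗ sU) (g := sV ∘ₗ P.mapQ N A h.le_comap_left)
      (f.ext fun x => ?_)
    rw [LinearMap.comp_apply, LinearMap.comp_apply, (hf x.1 x.2).1, Basis.constr_basis,
      Basis.constr_basis]
    exact (hss _ _).1
  have hsB : ∀ q, B (sU q) = sV (P.mapQ N B h.le_comap_right q) := by
    refine LinearMap.congr_fun (f := B ∘ₗ sU) (g := sV ∘ₗ P.mapQ N B h.le_comap_right)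
      (f.ext fun x => ?_)
    rw [LinearMap.comp_apply, LinearMap.comp_apply, (hf x.1 x.2).2, Basis.constr_basis,
      Basis.constr_basis]
    exact (hss _ _).2
  refine (hb.prodMap hb').map (LinearEquiv.ofBijective _ (P.bijective_subtype_coprod hsU))
    (LinearEquiv.ofBijective _ (N.bijective_subtype_coprod hsV)) ?_ ?_
  · rintro ⟨p, q⟩
    simp [hsA]
  · rintro ⟨p, q⟩
    simp [hsB]

end IsSurjectiveOn

end Splitting

/-! ### Pencils of constant rank -/

section GenericInjectivity

variable {K U V : Type*} [Field K] [AddCommGroup U] [Module K U] [AddCommGroup V] [Module K V]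
  [FiniteDimensional K U] {A B : U →ₗ[K] V}

/-- With a left inverse `L` of `B`, a kernel vector of `A + t B` is an eigenvector of `L A` with
eigenvalue `-t`. -/
theorem finite_not_injective_of_injective_right (hB : Function.Injective B) :
    {t : K | ¬ Function.Injective (A + t • B)}.Finite := by
  obtain ⟨L, hL⟩ := B.exists_leftInverse_of_injective (LinearMap.ker_eq_bot.2 hB)
  refine ((End.finite_hasEigenvalue (L ∘ₗ A)).image fun μ => -μ).subset fun t ht => ?_
  rw [Set.mem_ofPred_eq, ← LinearMap.ker_eq_bot, LinearMap.ker_eq_bot'] at ht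
  push Not at ht
  obtain ⟨u, hu, hu0⟩ := ht
  refine ⟨-t, End.hasEigenvalue_of_hasEigenvector (x := u)
    (End.hasEigenvector_iff.2 ⟨End.mem_eigenspace_iff.2 ?_, hu0⟩), neg_neg t⟩
  have h1 := congrArg L hu
  have h2 := LinearMap.congr_fun hL u
  simp only [LinearMap.add_apply, LinearMap.smul_apply, map_add, map_smul, map_zero,
    LinearMap.comp_apply, LinearMap.id_apply] at h1 h2 ⊢
  rw [h2] at h1
  rw [eq_neg_of_add_eq_zero_left h1, neg_smul]

theorem finite_not_injective_of_injective_left (hA : Function.Injective A) :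
    {t : K | ¬ Function.Injective (A + t • B)}.Finite := by
  refine ((finite_not_injective_of_injective_right (A := B) hA).image fun s => s⁻¹).subset
    fun t ht => ⟨t⁻¹, fun h => ht fun u v huv => ?_, inv_inv t⟩
  by_cases ht0 : t = 0
  · subst ht0
    exact hA (by simpa using huv)
  · refine h ?_
    have := congrArg (fun w => t⁻¹ • w) huv
    simpa [smul_smul, ht0, add_comm] using this

end GenericInjectivity

section ConstantRank

variable {K U V : Type*} [Field K] [AddCommGroup U] [Module K U] [AddCommGroup V] [Module K V]

/-- The starting points of infinite chains `y` with `A (y i) = B (y (i + 1))`. -/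
def chainSubmodule (A B : U →ₗ[K] V) : Submodule K U where
  carrier := {w | ∃ y : ℕ → U, y 0 = w ∧ ∀ i, A (y i) = B (y (i + 1))}
  zero_mem' := ⟨0, rfl, by simp⟩
  add_mem' := by
    rintro _ _ ⟨y, rfl, hy⟩ ⟨z, rfl, hz⟩
    exact ⟨y + z, rfl, fun i => by simp [hy, hz]⟩
  smul_mem' := by
    rintro c _ ⟨y, rfl, hy⟩
    exact ⟨c • y, rfl, fun i => by simp [hy]⟩

/-- A chain can be prolonged at its start or have its first term dropped. Consequently `A` induces
an injection from the quotient by the chain submodule `W` to the quotient by `B W`. -/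
theorem comap_map_chainSubmodule (A B : U →ₗ[K] V) :
    ((chainSubmodule A B).map B).comap A = chainSubmodule A B := by
  ext w
  constructor
  · rintro ⟨_, ⟨y, rfl, hy⟩, hw⟩
    refine ⟨fun i => Nat.casesOn i w y, rfl, fun i => ?_⟩
    cases i with
    | zero => exact hw.symm
    | succ i => exact hy i
  · rintro ⟨y, rfl, hy⟩
    exact ⟨y 1, ⟨fun i => y (i + 1), rfl, fun i => hy _⟩, (hy 0).symm⟩

/-- Let `W` be the chain submodule. If `B` is injective on `W`, then `A + t B` is injective for
almost all `t` both on `W` and on `U ⧸ W`, where `A` is injective. Otherwise a nonzero kernel vector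
of `B` in `W` starts the chain. -/
theorem exists_injective_or_exists_chain [Infinite K] [FiniteDimensional K U] (A B : U →ₗ[K] V) :
    (∃ t : K, Function.Injective (A + t • B)) ∨
      ∃ y : ℕ → U, y 0 ≠ 0 ∧ B (y 0) = 0 ∧ ∀ i, A (y i) = B (y (i + 1)) := by
  by_cases hker : LinearMap.ker (B.domRestrict (chainSubmodule A B)) = ⊥
  · left
    set W := chainSubmodule A B with hW
    have hWA : W ≤ (W.map B).comap A := (comap_map_chainSubmodule A B).ge
    have hWB : W ≤ (W.map B).comap B := Submodule.le_comap_map _ _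
    have hQ : Function.Injective (W.mapQ (W.map B) A hWA) := by
      rw [← LinearMap.ker_eq_bot, LinearMap.ker_eq_bot']
      intro q hq
      obtain ⟨u, rfl⟩ := W.mkQ_surjective q
      rw [Submodule.mkQ_apply, Submodule.mapQ_apply, Submodule.Quotient.mk_eq_zero] at hq
      rw [Submodule.mkQ_apply, Submodule.Quotient.mk_eq_zero, hW, ← comap_map_chainSubmodule]
      exact hq
    obtain ⟨t, ht⟩ := ((finite_not_injective_of_injective_right (A := A.domRestrict W)
      (LinearMap.ker_eq_bot.1 hker)).union (finite_not_injective_of_injective_left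
        (B := W.mapQ (W.map B) B hWB) hQ)).exists_notMem
    simp only [Set.mem_union, Set.mem_ofPred_eq, not_or, not_not] at ht
    refine ⟨t, ?_⟩
    rw [← LinearMap.ker_eq_bot, LinearMap.ker_eq_bot']
    intro u hu
    have huW : u ∈ W := by
      rw [← Submodule.Quotient.mk_eq_zero W]
      refine (map_eq_zero_iff _ ht.2).1 ?_
      have := congrArg (W.map B).mkQ hu
      simpa using this
    exact congrArg Subtype.val ((map_eq_zero_iff _ ht.1 (x := (⟨u, huW⟩ : W))).1 hu)
  · right
    rw [LinearMap.ker_eq_bot'] at hker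
    push Not at hker
    obtain ⟨⟨_, y, rfl, hy⟩, h0, hne⟩ := hker
    exact ⟨y, fun h => hne (Subtype.ext h), h0, hy⟩

/-- The member `α A + β B` sends `y i` to `α A (y i) + β A (y (i - 1))`, without the second term for
`i = 0`. This is triangular if `α ≠ 0` and a shift if `α = 0`. -/
theorem isSurjectiveOn_span_range {A B : U →ₗ[K] V} {y : ℕ → U} (h0 : B (y 0) = 0)
    (hy : ∀ i, A (y i) = B (y (i + 1))) :
    IsSurjectiveOn A B (Submodule.span K (Set.range y))
      (Submodule.span K (Set.range fun i => A (y i))) := by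
  intro α β h
  rw [Submodule.map_span]
  refine le_antisymm (Submodule.span_le.2 ?_) (Submodule.span_le.2 ?_)
  · rintro _ ⟨_, ⟨i, rfl⟩, rfl⟩
    refine Submodule.add_mem _ (Submodule.smul_mem _ _ (Submodule.subset_span ⟨i, rfl⟩))
      (Submodule.smul_mem _ _ ?_)
    cases i with
    | zero => rw [h0]; exact Submodule.zero_mem _
    | succ i => rw [← hy]; exact Submodule.subset_span ⟨i, rfl⟩
  · have hmem : ∀ i, (α • A + β • B) (y i) ∈
        Submodule.span K ((α • A + β • B) '' Set.range y) :=
      fun i => Submodule.subset_span ⟨_, ⟨i, rfl⟩, rfl⟩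
    rintro _ ⟨i, rfl⟩
    by_cases hα : α = 0
    · have := hmem (i + 1)
      rw [LinearMap.add_apply, LinearMap.smul_apply, LinearMap.smul_apply, ← hy,
        show α • A (y (i + 1)) = 0 by rw [hα, zero_smul], zero_add,
        Submodule.smul_mem_iff _ (h.resolve_left (not_not_intro hα))] at this
      exact this
    · induction i with
      | zero =>
        have := hmem 0
        rw [LinearMap.add_apply, LinearMap.smul_apply, LinearMap.smul_apply, h0, smul_zero,
          add_zero, Submodule.smul_mem_iff _ hα] at this
        exact this
      | succ i ih =>
        have := Submodule.sub_mem _ (hmem (i + 1)) (Submodule.smul_mem _ β ih)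
        rw [LinearMap.add_apply, LinearMap.smul_apply, LinearMap.smul_apply, ← hy,
          add_sub_cancel_right, Submodule.smul_mem_iff _ hα] at this
        exact this

theorem IsSurjectiveOn.comap_mkQ {A B : U →ₗ[K] V} {P : Submodule K U} {N : Submodule K V}
    (h : IsSurjectiveOn A B P N) {P' : Submodule K (U ⧸ P)} {N' : Submodule K (V ⧸ N)}
    (h' : IsSurjectiveOn (P.mapQ N A h.le_comap_left) (P.mapQ N B h.le_comap_right) P' N') :
    IsSurjectiveOn A B (P'.comap P.mkQ) (N'.comap N.mkQ) := by
  intro α β h0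
  have hf : ∀ u, N.mkQ ((α • A + β • B) u) = (α • P.mapQ N A h.le_comap_left +
      β • P.mapQ N B h.le_comap_right) (P.mkQ u) := fun u => by simp
  ext v
  constructor
  · rintro ⟨u, hu, rfl⟩
    rw [Submodule.mem_comap, hf, ← h' α β h0]
    exact Submodule.mem_map_of_mem hu
  · intro hv
    rw [Submodule.mem_comap, ← h' α β h0] at hv
    obtain ⟨q, hq, hqv⟩ := hv
    obtain ⟨u, rfl⟩ := P.mkQ_surjective q
    rw [← hf, ← sub_eq_zero, ← map_sub, ← LinearMap.mem_ker, N.ker_mkQ, ← N.neg_mem_iff, neg_sub,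
      ← h α β h0] at hqv
    obtain ⟨p, hp, hpv⟩ := hqv
    refine ⟨p + u, Submodule.add_mem _ ?_ hq, by rw [map_add, hpv, sub_add_cancel]⟩
    have : P.mkQ p = 0 := (Submodule.Quotient.mk_eq_zero P).2 hp
    rw [Submodule.mem_comap, this]
    exact Submodule.zero_mem _

theorem finrank_range_eq_add_of_quotient [FiniteDimensional K V] {f : U →ₗ[K] V}
    {P : Submodule K U} {N : Submodule K V} (hN : N ≤ LinearMap.range f) {g : U ⧸ P →ₗ[K] V ⧸ N}
    (hg : ∀ u, g (P.mkQ u) = N.mkQ (f u)) :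
    finrank K (LinearMap.range f) = finrank K N + finrank K (LinearMap.range g) := by
  have h1 := (N.mkQ.domRestrict (LinearMap.range f)).finrank_range_add_finrank_ker
  have h2 : LinearMap.range (N.mkQ.domRestrict (LinearMap.range f)) = LinearMap.range g := by
    ext w
    constructor
    · rintro ⟨⟨_, u, rfl⟩, rfl⟩
      exact ⟨P.mkQ u, hg u⟩
    · rintro ⟨q, rfl⟩
      obtain ⟨u, rfl⟩ := P.mkQ_surjective q
      exact ⟨⟨f u, u, rfl⟩, (hg u).symm⟩
  have h3 : LinearMap.ker (N.mkQ.domRestrict (LinearMap.range f)) =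
      N.comap (LinearMap.range f).subtype := by
    ext w
    simp
  rw [h2, h3, (Submodule.comapSubtypeEquivOfLe hN).finrank_eq] at h1
  omega

/-- For `P` maximal, the quotient pencil again has constant rank. If one member is injective, all
are, by rank; otherwise a chain in the quotient would enlarge `P`. -/
theorem HasConstantRank.exists_isSurjectiveOn [Infinite K] [FiniteDimensional K U]
    [FiniteDimensional K V] {A B : U →ₗ[K] V} (h : HasConstantRank A B) :
    ∃ (P : Submodule K U) (N : Submodule K V) (hs : IsSurjectiveOn A B P N),
      IsInjectivePencil (P.mapQ N A hs.le_comap_left) (P.mapQ N B hs.le_comap_right) := by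
  obtain ⟨r, hr⟩ := h
  obtain ⟨P, ⟨N, hs⟩, hmax⟩ := (wellFounded_gt (α := Submodule K U)).has_min
    {P | ∃ N, IsSurjectiveOn A B P N} ⟨⊥, ⊥, fun _ _ _ => Submodule.map_bot _⟩
  refine ⟨P, N, hs, fun α β h0 u hu => ?_⟩
  have hrank : ∀ α β : K, (α ≠ 0 ∨ β ≠ 0) → r = finrank K N + finrank K (LinearMap.range
      (α • P.mapQ N A hs.le_comap_left + β • P.mapQ N B hs.le_comap_right)) := fun α β h0 => by
    rw [← hr α β h0]
    refine finrank_range_eq_add_of_quotient ?_ fun u => by simp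
    rw [← hs α β h0]
    exact LinearMap.map_le_range
  rcases exists_injective_or_exists_chain (P.mapQ N A hs.le_comap_left)
    (P.mapQ N B hs.le_comap_right) with ⟨t, ht⟩ | ⟨y, hy0, hyB, hy⟩
  · have h1 := hrank 1 t (by simp)
    rw [one_smul, LinearMap.finrank_range_of_inj ht] at h1
    have h2 := hrank α β h0
    have h3 := (α • P.mapQ N A hs.le_comap_left +
      β • P.mapQ N B hs.le_comap_right).finrank_range_add_finrank_ker
    have h4 : LinearMap.ker (α • P.mapQ N A hs.le_comap_left +
      β • P.mapQ N B hs.le_comap_right) = ⊥ := Submodule.finrank_eq_zero.1 (by omega)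
    exact LinearMap.ker_eq_bot'.1 h4 u hu
  · refine absurd ?_ (hmax _ ⟨_, hs.comap_mkQ (isSurjectiveOn_span_range hyB hy)⟩)
    obtain ⟨w, hw⟩ := P.mkQ_surjective (y 0)
    refine lt_of_le_of_ne (fun p hp => ?_) fun hP => hy0 ?_
    · have : P.mkQ p = 0 := (Submodule.Quotient.mk_eq_zero P).2 hp
      rw [Submodule.mem_comap, this]
      exact Submodule.zero_mem _
    · have hwP : w ∈ P := by
        rw [hP, Submodule.mem_comap, hw]
        exact Submodule.subset_span ⟨0, rfl⟩
      rw [← hw]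
      exact (Submodule.Quotient.mk_eq_zero P).2 hwP

theorem HasConstantRank.hasNoJordanBlocks [IsAlgClosed K] [FiniteDimensional K U]
    [FiniteDimensional K V] {A B : U →ₗ[K] V} (h : HasConstantRank A B) :
    HasNoJordanBlocks A B := by
  have := IsAlgClosed.instInfinite (K := K)
  obtain ⟨P, N, hs, hinj⟩ := h.exists_isSurjectiveOn
  have hv := hinj.isVerticalSum
  obtain ⟨ι, _, e, he⟩ := hs.exists_isPencilForm
  obtain ⟨κ, _, e', he'⟩ := hv.exists_isPencilForm
  obtain ⟨k, σ, hσ⟩ := (hs.isPencilForm_of_quotient he he' hv).exists_isKroneckerForm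
  refine ⟨k, _, hσ, fun i => ?_⟩
  rcases hi : σ i with j | j <;> exact (by simp [PencilBlock.IsJordan])

end ConstantRank

/-! ### Generic lines and sets of codimension at least two -/

-- Otherwise some prime ideal `P` contains `S` but no nonzero constant. It contains a prime `q` of
-- positive degree, irreducible over the fraction field by Gauss's lemma and hence coprime there to
-- some `p ∈ S`. Clearing denominators in a Bézout identity puts a nonzero constant into `P`.
open Polynomial in
theorem Polynomial.exists_C_mem_span_of_forall_prime {R : Type*} [CommRing R] [IsDomain R]
    [UniqueFactorizationMonoid R] {S : Set R[X]} (hS : ∃ p ∈ S, p ≠ 0)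
    (h : ∀ q : R[X], Prime q → ∃ p ∈ S, ¬ q ∣ p) : ∃ d : R, d ≠ 0 ∧ C d ∈ Ideal.span S := by
  by_contra! hd
  have hdisj : Disjoint (Ideal.span S : Set R[X]) ((nonZeroDivisors R).map (C : R →+* R[X])) := by
    rw [Set.disjoint_left]
    rintro _ hm ⟨d, hd0, rfl⟩
    exact hd d (nonZeroDivisors.ne_zero hd0) hm
  obtain ⟨P, hP, hSP, hPd⟩ := Ideal.exists_le_prime_disjoint _ _ hdisj
  have hPC : ∀ d : R, C d ∈ P → d = 0 := fun d hdP => by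
    by_contra hd0
    exact Set.disjoint_left.1 hPd hdP ⟨d, mem_nonZeroDivisors_of_ne_zero hd0, rfl⟩
  obtain ⟨p₀, hp₀S, hp₀⟩ := hS
  obtain ⟨q, hqP, hq⟩ := hP.exists_mem_prime_of_ne_bot
    ((Submodule.ne_bot_iff _).2 ⟨p₀, hSP (Ideal.subset_span hp₀S), hp₀⟩)
  obtain ⟨p, hpS, hqp⟩ := h q hq
  have hdeg : q.natDegree ≠ 0 := fun h0 => by
    rw [eq_C_of_natDegree_eq_zero h0] at hqP
    refine hq.ne_zero ?_
    rw [eq_C_of_natDegree_eq_zero h0, hPC _ hqP, C_0]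
  have hprim := hq.irreducible.isPrimitive hdeg
  let L := FractionRing R
  have hirr := (hprim.irreducible_iff_irreducible_map_fraction_map (K := L)).1 hq.irreducible
  rw [hprim.dvd_iff_fraction_map_dvd_fraction_map L] at hqp
  obtain ⟨u, v, huv⟩ := (hirr.coprime_iff_not_dvd).2 hqp
  obtain ⟨b, hb, hu⟩ := IsLocalization.integerNormalization_spec (nonZeroDivisors R) u
  obtain ⟨c, hc, hv⟩ := IsLocalization.integerNormalization_spec (nonZeroDivisors R) v
  set u' := IsLocalization.integerNormalization (nonZeroDivisors R) u
  set v' := IsLocalization.integerNormalization (nonZeroDivisors R) v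
  have key : C (b * c) = (C c * u') * q + (C b * v') * p := by
    refine map_injective (algebraMap R L) (IsFractionRing.injective R L) ?_
    simp only [Polynomial.map_add, Polynomial.map_mul, map_C, hu, hv, map_mul]
    rw [Algebra.smul_def, Algebra.smul_def, IsScalarTower.algebraMap_apply R L L[X],
      IsScalarTower.algebraMap_apply R L L[X], ← C_eq_algebraMap]
    linear_combination (- C ((algebraMap R L) b) * C ((algebraMap R L) c)) * huv
  have hmem : C (b * c) ∈ P := by
    rw [key]
    exact P.add_mem (P.mul_mem_left _ hqP) (P.mul_mem_left _ (hSP (Ideal.subset_span hpS)))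
  exact mul_ne_zero (nonZeroDivisors.ne_zero hb) (nonZeroDivisors.ne_zero hc) (hPC _ hmem)

namespace MvPolynomial

variable {K σ : Type*} [Field K]

/-- The substitution `xᵢ ↦ xᵢ + t aᵢ`; the variables `aᵢ` and `xᵢ` are indexed by `Sum.inl i` and
`Sum.inr i`. -/
noncomputable def lineHom (K σ : Type*) [Field K] :
    MvPolynomial σ K →ₐ[K] Polynomial (MvPolynomial (σ ⊕ σ) K) :=
  aeval fun i => Polynomial.C (X (Sum.inr i)) + Polynomial.X * Polynomial.C (X (Sum.inl i))

/-- The substitution `xᵢ ↦ xᵢ + s t aᵢ` on polynomials in `x, a, t`. -/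
noncomputable def shearHom (σ : Type*) (s : K) :
    Polynomial (MvPolynomial (σ ⊕ σ) K) →+* Polynomial (MvPolynomial (σ ⊕ σ) K) :=
  Polynomial.eval₂RingHom
    (aeval (R := K) (Sum.elim (fun i => Polynomial.C (X (Sum.inl i))) fun i =>
      Polynomial.C (X (Sum.inr i)) +
        Polynomial.C (C s) * Polynomial.X * Polynomial.C (X (Sum.inl i)))).toRingHom
    Polynomial.X

theorem shearHom_comp (s s' : K) (h : s + s' = 0) :
    (shearHom σ s).comp (shearHom σ s') = RingHom.id _ := by
  refine Polynomial.ringHom_ext' (MvPolynomial.ringHom_ext (fun c => ?_) ?_) ?_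
  · simp [shearHom, algebraMap_eq, Polynomial.algebraMap_apply]
  · rintro (i | i)
    · simp [shearHom]
    · have hs : (C s : MvPolynomial (σ ⊕ σ) K) + C s' = 0 := by rw [← C_add, h, C_0]
      have hs' := congrArg (Polynomial.C) hs
      rw [Polynomial.C_add, Polynomial.C_0] at hs'
      simp [shearHom, algebraMap_eq, Polynomial.algebraMap_apply]
      linear_combination (Polynomial.X * Polynomial.C (X (Sum.inl i))) * hs'
  · simp [shearHom]

/-- `shearHom` as an automorphism. -/
noncomputable def shearEquiv (K σ : Type*) [Field K] :
    Polynomial (MvPolynomial (σ ⊕ σ) K) ≃+* Polynomial (MvPolynomial (σ ⊕ σ) K) :=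
  RingEquiv.ofRingHom (shearHom σ 1) (shearHom σ (-1)) (shearHom_comp _ _ (by simp))
    (shearHom_comp _ _ (by simp))

/-- Substituting the line is an inclusion of polynomial rings followed by an automorphism, so it
preserves primes and reflects divisibility. -/
theorem lineHom_eq_shearEquiv (p : MvPolynomial σ K) :
    lineHom K σ p = shearEquiv K σ (Polynomial.C (rename Sum.inr p)) := by
  have : (lineHom K σ).toRingHom = ((shearEquiv K σ).toRingHom.comp Polynomial.C).comp
      (rename Sum.inr).toRingHom := by
    refine MvPolynomial.ringHom_ext (fun c => ?_) fun i => ?_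
    · simp [lineHom, shearEquiv, shearHom, algebraMap_eq, Polynomial.algebraMap_apply]
    · simp [lineHom, shearEquiv, shearHom]
  exact RingHom.congr_fun this p

theorem prime_rename_inr {τ : Type*} {p : MvPolynomial σ K} (hp : Prime p) :
    Prime (rename (Sum.inr : σ → τ ⊕ σ) p) := by
  rw [← MulEquiv.prime_iff (sumAlgEquiv K τ σ)]
  have : ((sumAlgEquiv K τ σ).toAlgHom.comp (rename Sum.inr)).toRingHom = C := by
    refine MvPolynomial.ringHom_ext (fun c => ?_) fun i => ?_
    · simp [algebraMap_eq]
    · simp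
  have h := RingHom.congr_fun this p
  change sumAlgEquiv K τ σ (rename Sum.inr p) = C p at h
  rw [h]
  exact (prime_C_iff τ).2 hp

theorem prime_lineHom {p : MvPolynomial σ K} (hp : Prime p) : Prime (lineHom K σ p) := by
  rw [lineHom_eq_shearEquiv, MulEquiv.prime_iff, Polynomial.prime_C_iff]
  exact prime_rename_inr hp

/-- Evaluation of a polynomial in `x, a, t`. -/
noncomputable def lineEval (x a : σ → K) (t : K) :
    Polynomial (MvPolynomial (σ ⊕ σ) K) →+* K :=
  Polynomial.eval₂RingHom (eval (Sum.elim a x)) t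

theorem lineEval_C (x a : σ → K) (t : K) (d : MvPolynomial (σ ⊕ σ) K) :
    lineEval x a t (Polynomial.C d) = eval (Sum.elim a x) d := by
  simp [lineEval]

theorem lineEval_lineHom (x a : σ → K) (t : K) (p : MvPolynomial σ K) :
    lineEval x a t (lineHom K σ p) = eval (x + t • a) p := by
  have : (lineEval x a t).comp (lineHom K σ).toRingHom = eval (x + t • a) := by
    refine MvPolynomial.ringHom_ext (fun c => ?_) fun i => ?_
    · simp [lineEval, algebraMap_eq, Polynomial.algebraMap_apply]
    · simp [lineEval, lineHom]
      ring
  exact RingHom.congr_fun this p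

theorem dvd_of_lineHom_dvd {p q : MvPolynomial σ K} (h : lineHom K σ q ∣ lineHom K σ p) :
    q ∣ p := by
  rw [lineHom_eq_shearEquiv, lineHom_eq_shearEquiv, map_dvd_iff, Polynomial.C_dvd_iff_dvd_coeff] at h
  -- Setting `a = 0` in the constant coefficient retracts `K[x, a]` onto `K[x]`.
  have h0 := map_dvd (aeval (R := K) (Sum.elim 0 (X : σ → MvPolynomial σ K))) (h 0)
  rw [Polynomial.coeff_C_zero, aeval_rename, aeval_rename, Sum.elim_comp_inr, aeval_X_left] at h0
  exact h0

theorem exists_forall_exists_eval_line_ne_zero {S : Set (MvPolynomial σ K)}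
    (hS : ∃ p ∈ S, p ≠ 0) (h : ∀ q : MvPolynomial σ K, Prime q → ∃ p ∈ S, ¬ q ∣ p) :
    ∃ d : MvPolynomial (σ ⊕ σ) K, d ≠ 0 ∧ ∀ x a : σ → K, eval (Sum.elim a x) d ≠ 0 →
      ∀ t : K, ∃ p ∈ S, eval (x + t • a) p ≠ 0 := by
  obtain ⟨p₀, hp₀S, hp₀⟩ := hS
  have hinj : ∀ p, lineHom K σ p = 0 → p = 0 := fun p hp =>
    zero_dvd_iff.1 (dvd_of_lineHom_dvd (by rw [hp, map_zero]))
  obtain ⟨d, hd, hdS⟩ := Polynomial.exists_C_mem_span_of_forall_prime (S := lineHom K σ '' S)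
    ⟨_, ⟨p₀, hp₀S, rfl⟩, fun h => hp₀ (hinj _ h)⟩ (by
      intro q hq
      by_contra! hall
      -- A common prime factor `q` of the `p (x + t a)` contracts to a nonzero prime ideal of
      -- `K[x]`. A prime `q'` in it stays prime after substitution, so it becomes associated to `q`
      -- and then divides all of `S`.
      have hP : ((Ideal.span {q}).comap (lineHom K σ)).IsPrime :=
        have := (Ideal.span_singleton_prime hq.ne_zero).2 hq
        Ideal.comap_isPrime _ _
      obtain ⟨q', hq'P, hq'⟩ := hP.exists_mem_prime_of_ne_bot ((Submodule.ne_bot_iff _).2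
        ⟨p₀, Ideal.mem_span_singleton.2 (hall _ ⟨p₀, hp₀S, rfl⟩), hp₀⟩)
      obtain ⟨p, hpS, hp⟩ := h q' hq'
      have hdvd : q ∣ lineHom K σ q' := Ideal.mem_span_singleton.1 hq'P
      exact hp (dvd_of_lineHom_dvd
        ((hq.associated_of_dvd (prime_lineHom hq') hdvd).symm.dvd.trans (hall _ ⟨p, hpS, rfl⟩))))
  refine ⟨d, hd, fun x a hxa t => ?_⟩
  by_contra! hall
  have hle : Ideal.span (lineHom K σ '' S) ≤ RingHom.ker (lineEval x a t) := by
    rw [Ideal.span_le]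
    rintro _ ⟨p, hp, rfl⟩
    exact (lineEval_lineHom x a t p).trans (hall p hp)
  exact hxa ((lineEval_C x a t d).symm.trans (hle hdS))

theorem exists_forall_exists_eval_line_eq_zero [IsAlgClosed K] {q : MvPolynomial σ K}
    (hq : Prime q) : ∃ d : MvPolynomial (σ ⊕ σ) K, d ≠ 0 ∧
      ∀ x a : σ → K, eval (Sum.elim a x) d ≠ 0 → ∃ t : K, eval (x + t • a) q = 0 := by
  have := IsAlgClosed.instInfinite (K := K)
  by_cases hdeg : (lineHom K σ q).natDegree = 0
  · exfalso
    have hC := Polynomial.eq_C_of_natDegree_eq_zero hdeg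
    set r := (lineHom K σ q).coeff 0
    have key : ∀ x a : σ → K, ∀ t : K, eval (x + t • a) q = eval (Sum.elim a x) r := by
      intro x a t
      rw [← lineEval_lineHom, hC, lineEval_C]
    -- On lines through `x = 0`, independence of `t` equates the values of `q` at `a` and at `0`.
    have hconst : q = C (eval 0 q) := MvPolynomial.funext fun a => by
      have h1 := key 0 a 1
      have h2 := key 0 a 0
      rw [← h2] at h1
      simpa using h1
    rw [hconst] at hq
    by_cases h0 : eval 0 q = 0
    · rw [h0, C_0] at hq
      exact hq.ne_zero rfl
    · exact hq.not_isUnit ((isUnit_iff_ne_zero.2 h0).map C)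
  -- Where the leading coefficient in `t` does not vanish, specialising `(x, a)` keeps the degree
  -- positive, so a root exists.
  · refine ⟨(lineHom K σ q).leadingCoeff, fun h => ?_, fun x a hxa => ?_⟩
    · rw [Polynomial.leadingCoeff_eq_zero] at h
      exact hdeg (by rw [h, Polynomial.natDegree_zero])
    · have hd : ((lineHom K σ q).map (eval (Sum.elim a x))).degree ≠ 0 := by
        rw [Polynomial.degree_map_eq_of_leadingCoeff_ne_zero _ hxa]
        exact fun h => hdeg (Polynomial.natDegree_eq_of_degree_eq_some h)
      obtain ⟨t, ht⟩ := IsAlgClosed.exists_root _ hd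
      refine ⟨t, ?_⟩
      rw [← lineEval_lineHom]
      rwa [Polynomial.IsRoot, Polynomial.eval_map] at ht

/-- If `q` divides all of `S`, the zero set contains the hypersurface `q = 0`, and by the
Nullstellensatz the vanishing ideal lies in `(q)`, of height at most 1. Conversely, a prime over the
vanishing ideal contains a prime `q`, and strictly contains `(q)` when `q` does not divide all of
`S`, so its height is at least 2. -/
theorem two_le_height_vanishingIdeal_iff [IsAlgClosed K] [Finite σ] {S : Set (MvPolynomial σ K)}
    (hS : ∃ p ∈ S, p ≠ 0) :
    2 ≤ (vanishingIdeal K {v : σ → K | ∀ p ∈ S, eval v p = 0}).height ↔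
      ∀ q : MvPolynomial σ K, Prime q → ∃ p ∈ S, ¬ q ∣ p := by
  constructor
  · intro h q hq
    by_contra! hall
    have := (Ideal.span_singleton_prime hq.ne_zero).2 hq
    have hle : vanishingIdeal K {v : σ → K | ∀ p ∈ S, eval v p = 0} ≤ Ideal.span {q} := by
      rw [← IsPrime.vanishingIdeal_zeroLocus (K := K) (Ideal.span {q})]
      refine vanishingIdeal_anti_mono fun v hv p hp => ?_
      have hq0 := hv q (Ideal.mem_span_singleton_self q)
      obtain ⟨r, rfl⟩ := hall p hp
      rw [map_mul, show eval v q = 0 from hq0, zero_mul]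
    have h1 := Ideal.height_le_one_of_isPrincipal_of_mem_minimalPrimes (Ideal.span {q})
      (Ideal.span {q}) (by rw [Ideal.minimalPrimes_eq_subsingleton_self]; rfl)
    exact absurd (h.trans ((Ideal.height_mono hle).trans h1)) (by decide)
  · intro h
    by_contra! hlt
    obtain ⟨n, hn⟩ := ENat.ne_top_iff_exists.1 (ne_top_of_lt hlt)
    obtain ⟨P, hP, hIP, hPn⟩ := Ideal.exists_isPrime_height_eq hn.symm
    have hSP : ∀ p ∈ S, p ∈ P := fun p hp => hIP fun v hv => hv p hp
    obtain ⟨p₀, hp₀S, hp₀⟩ := hS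
    obtain ⟨q, hqP, hq⟩ := hP.exists_mem_prime_of_ne_bot
      ((Submodule.ne_bot_iff _).2 ⟨p₀, hSP p₀ hp₀S, hp₀⟩)
    obtain ⟨p, hpS, hqp⟩ := h q hq
    have := (Ideal.span_singleton_prime hq.ne_zero).2 hq
    have hlt' : Ideal.span {q} < P := lt_of_le_of_ne
      ((Ideal.span_singleton_le_iff_mem _).2 hqP) fun he =>
        hqp (Ideal.mem_span_singleton.1 (he ▸ hSP p hpS))
    have h1 := Ideal.height_add_one_le_of_lt_of_isPrime hlt'
    have h2 := Ideal.one_le_height_span_singleton_of_mem_nonZeroDivisors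
      (mem_nonZeroDivisors_of_ne_zero hq.ne_zero)
    rw [hPn, hn] at h1
    have h3 := (add_le_add_left h2 1).trans h1
    rw [one_add_one_eq_two] at h3
    exact absurd hlt (not_lt.2 h3)

theorem exists_forall_line_iff_two_le_height [IsAlgClosed K] [Finite σ]
    {S : Set (MvPolynomial σ K)} (hS : ∃ p ∈ S, p ≠ 0) :
    ∃ d : MvPolynomial (σ ⊕ σ) K, d ≠ 0 ∧ ∀ x a : σ → K, eval (Sum.elim a x) d ≠ 0 →
      ((∃ p ∈ S, eval a p ≠ 0) ∧ ((∀ t : K, ∃ p ∈ S, eval (x + t • a) p ≠ 0) ↔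
        2 ≤ (vanishingIdeal K {v : σ → K | ∀ p ∈ S, eval v p = 0}).height)) := by
  obtain ⟨p₀, hp₀S, hp₀⟩ := hS
  have hr : rename (Sum.inl : σ → σ ⊕ σ) p₀ ≠ 0 :=
    fun h => hp₀ (rename_injective _ Sum.inl_injective (by rw [h, map_zero]))
  have key : ∃ d : MvPolynomial (σ ⊕ σ) K, d ≠ 0 ∧ ∀ x a : σ → K, eval (Sum.elim a x) d ≠ 0 →
      ((∀ t : K, ∃ p ∈ S, eval (x + t • a) p ≠ 0) ↔
        2 ≤ (vanishingIdeal K {v : σ → K | ∀ p ∈ S, eval v p = 0}).height) := by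
    rw [two_le_height_vanishingIdeal_iff ⟨p₀, hp₀S, hp₀⟩]
    by_cases h : ∀ q : MvPolynomial σ K, Prime q → ∃ p ∈ S, ¬ q ∣ p
    · obtain ⟨d, hd, hdS⟩ := exists_forall_exists_eval_line_ne_zero ⟨p₀, hp₀S, hp₀⟩ h
      exact ⟨d, hd, fun x a hxa => iff_of_true (hdS x a hxa) h⟩
    · have h' := h
      push Not at h'
      obtain ⟨q, hq, hall⟩ := h'
      obtain ⟨d, hd, hdq⟩ := exists_forall_exists_eval_line_eq_zero hq
      refine ⟨d, hd, fun x a hxa => iff_of_false (fun ht => ?_) h⟩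
      obtain ⟨t, ht0⟩ := hdq x a hxa
      obtain ⟨p, hp, hpt⟩ := ht t
      obtain ⟨r, rfl⟩ := hall p hp
      exact hpt (by rw [map_mul, ht0, zero_mul])
  obtain ⟨d, hd, hdS⟩ := key
  -- The factor `p₀ (a)` keeps the direction `a`, the point of the line at `t = ∞`, out of the zero
  -- set.
  refine ⟨d * rename Sum.inl p₀, mul_ne_zero hd hr, fun x a hxa => ?_⟩
  rw [map_mul, eval_rename, Sum.elim_comp_inl] at hxa
  exact ⟨⟨p₀, hp₀S, right_ne_zero_of_mul hxa⟩, hdS x a (left_ne_zero_of_mul hxa)⟩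

end MvPolynomial

/-! ### Zariski open sets and minors -/

section ZariskiOpen

variable {K W : Type*} [Field K] [AddCommGroup W] [Module K W] [FiniteDimensional K W]

/-- A polynomial in linear functionals, in terms of the coordinates of `finBasis`. -/
theorem exists_eval_finBasis_eq {σ : Type*} (l : σ → W →ₗ[K] K) (d : MvPolynomial σ K) :
    ∃ p : MvPolynomial (Fin (finrank K W)) K, ∀ w : W,
      MvPolynomial.eval ((finBasis K W).equivFun w) p = MvPolynomial.eval (fun i => l i w) d := by
  refine ⟨MvPolynomial.bind₁ (fun i => ∑ j, MvPolynomial.C (l i (finBasis K W j)) *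
    MvPolynomial.X j) d, fun w => ?_⟩
  rw [MvPolynomial.eval, MvPolynomial.eval₂Hom_bind₁]
  congr 2
  funext i
  conv_rhs => rw [← (finBasis K W).sum_equivFun w, map_sum]
  simp only [map_smul, smul_eq_mul, map_sum, map_mul, MvPolynomial.eval₂Hom_C, RingHom.id_apply,
    MvPolynomial.eval₂Hom_X', mul_comm]

theorem isZariskiOpen_eval_ne_zero {σ : Type*} (l : σ → W →ₗ[K] K) (d : MvPolynomial σ K) :
    IsZariskiOpen K {w : W | MvPolynomial.eval (fun i => l i w) d ≠ 0} := by
  obtain ⟨p, hp⟩ := exists_eval_finBasis_eq l d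
  refine ⟨{p}, ?_⟩
  ext w
  constructor
  · intro hw
    exact ⟨p, rfl, (hp w).trans_ne hw⟩
  · rintro ⟨_, rfl, hw⟩
    exact (hp w).symm.trans_ne hw

theorem IsZariskiOpen.inter_nonempty [Infinite K] {S T : Set W} (hS : IsZariskiOpen K S)
    (hT : IsZariskiOpen K T) (hS' : S.Nonempty) (hT' : T.Nonempty) : (S ∩ T).Nonempty := by
  obtain ⟨P, rfl⟩ := hS
  obtain ⟨Q, rfl⟩ := hT
  obtain ⟨v, p, hp, hpv⟩ := hS'
  obtain ⟨w, q, hq, hqw⟩ := hT'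
  have hpq : p * q ≠ 0 := mul_ne_zero (fun h => hpv (by rw [h, map_zero]))
    fun h => hqw (by rw [h, map_zero])
  obtain ⟨c, hc⟩ : ∃ c, MvPolynomial.eval c (p * q) ≠ 0 := by
    by_contra! hall
    exact hpq (MvPolynomial.funext fun c => by rw [hall, map_zero])
  rw [map_mul] at hc
  refine ⟨(finBasis K W).equivFun.symm c, ⟨p, hp, ?_⟩, ⟨q, hq, ?_⟩⟩
  · rw [LinearEquiv.apply_symm_apply]
    exact left_ne_zero_of_mul hc
  · rw [LinearEquiv.apply_symm_apply]
    exact right_ne_zero_of_mul hc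

end ZariskiOpen

/-- A basis-free form of the rank criterion by minors. For the converse, coordinates dual to
independent vectors of the range give the identity matrix. -/
theorem LinearMap.exists_det_ne_zero_iff_le_finrank_range {K U V : Type*} [Field K]
    [AddCommGroup U] [Module K U] [AddCommGroup V] [Module K V] [FiniteDimensional K V]
    (f : U →ₗ[K] V) (r : ℕ) :
    (∃ (u : Fin r → U) (φ : Fin r → V →ₗ[K] K), (Matrix.of fun i j => φ i (f (u j))).det ≠ 0) ↔
      r ≤ finrank K (LinearMap.range f) := by
  constructor
  · rintro ⟨u, φ, h⟩
    have hli : LinearIndependent K fun j => f.rangeRestrict (u j) := by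
      rw [Fintype.linearIndependent_iff]
      intro c hc
      have h0 : (Matrix.of fun i j => φ i (f (u j))).mulVec c = 0 := by
        funext i
        have := congrArg (fun v : LinearMap.range f => φ i (v : V)) hc
        simpa [Matrix.mulVec, dotProduct, mul_comm] using this
      exact congrFun (Matrix.eq_zero_of_mulVec_eq_zero h h0)
    simpa using hli.fintype_card_le_finrank
  · intro h
    obtain ⟨v, hv⟩ := exists_linearIndependent_of_le_finrank h
    choose u hu using fun j => (v j).2
    have hw : LinearIndependent K fun j => (v j : V) :=
      hv.map' (LinearMap.range f).subtype (Submodule.ker_subtype _)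
    obtain ⟨L, hL⟩ := (Fintype.linearCombination K fun j => (v j : V)).exists_leftInverse_of_injective
      (LinearMap.ker_eq_bot.2 (linearIndependent_iff_injective_fintypeLinearCombination.1 hw))
    refine ⟨u, fun i => LinearMap.proj i ∘ₗ L, ?_⟩
    have hM : (Matrix.of fun i j => (LinearMap.proj i ∘ₗ L) (f (u j))) =
        (1 : Matrix (Fin r) (Fin r) K) := by
      ext i j
      have := congrFun (LinearMap.congr_fun hL (Pi.single j 1)) i
      simpa [hu, Matrix.one_apply, Pi.single_apply] using this
    rw [hM, Matrix.det_one]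
    exact one_ne_zero

/-! ### The singular set of a representation -/

namespace LieRep

variable {K 𝔤 V : Type*} [Field K] [LieRing 𝔤] [LieAlgebra K 𝔤]
  [AddCommGroup V] [Module K V] (ρ : 𝔤 →ₗ⁅K⁆ Module.End K V)

theorem isRegular_iff_forall_finrank_range_le [FiniteDimensional K 𝔤] {a : V} :
    IsRegular ρ a ↔
      ∀ x, finrank K (LinearMap.range (R ρ x)) ≤ finrank K (LinearMap.range (R ρ a)) := by
  refine forall_congr' fun x => ?_
  have h1 := (R ρ a).finrank_range_add_finrank_ker
  have h2 := (R ρ x).finrank_range_add_finrank_ker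
  change finrank K (LinearMap.ker (R ρ a)) ≤ finrank K (LinearMap.ker (R ρ x)) ↔ _
  omega

theorem exists_isRegular : ∃ a, IsRegular ρ a := by
  obtain ⟨a, -, ha⟩ := (measure fun a => finrank K (stabiliser ρ a)).wf.has_min Set.univ
    ⟨0, trivial⟩
  exact ⟨a, fun x => not_lt.1 (ha x trivial)⟩

theorem IsRegular.isRegular_iff [FiniteDimensional K 𝔤] {a : V} (ha : IsRegular ρ a) {x : V} :
    IsRegular ρ x ↔
      finrank K (LinearMap.range (R ρ x)) = finrank K (LinearMap.range (R ρ a)) := by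
  rw [isRegular_iff_forall_finrank_range_le] at ha ⊢
  exact ⟨fun hx => le_antisymm (ha x) (hx a), fun h y => h ▸ ha y⟩

/-- Up to a nonzero scalar, the members of the pencil are `R_a` and the operators `R_{x + t a}`. -/
theorem IsRegular.hasConstantRank_iff [FiniteDimensional K 𝔤] {a : V} (ha : IsRegular ρ a) {x : V} :
    HasConstantRank (R ρ x) (R ρ a) ↔ ∀ t : K, IsRegular ρ (x + t • a) := by
  have hlin : ∀ α β : K, α • R ρ x + β • R ρ a = R ρ (α • x + β • a) := fun α β => by simp
  constructor
  · rintro ⟨r, hr⟩ t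
    have h1 := hr 0 1 (by simp)
    have h2 := hr 1 t (by simp)
    rw [hlin, zero_smul, zero_add, one_smul] at h1
    rw [hlin, one_smul] at h2
    rw [ha.isRegular_iff, h1, h2]
  · intro h
    refine ⟨finrank K (LinearMap.range (R ρ a)), fun α β h0 => ?_⟩
    by_cases hα : α = 0
    · rw [hα, zero_smul, zero_add, LinearMap.range_smul _ _ (h0.resolve_left (not_not_intro hα))]
    · have : α • R ρ x + β • R ρ a = α • R ρ (x + (α⁻¹ * β) • a) := by
        rw [hlin, ← map_smul, smul_add, smul_smul, mul_inv_cancel_left₀ hα]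
      rw [this, LinearMap.range_smul _ _ hα]
      exact (ha.isRegular_iff ρ).1 (h _)

theorem exists_isRegular_iff_exists_eval_ne_zero [FiniteDimensional K 𝔤] [FiniteDimensional K V] :
    ∃ S : Set (MvPolynomial (Fin (finrank K V)) K), ∀ y : V,
      IsRegular ρ y ↔ ∃ p ∈ S, MvPolynomial.eval ((finBasis K V).equivFun y) p ≠ 0 := by
  obtain ⟨a, ha⟩ := exists_isRegular ρ
  set r := finrank K (LinearMap.range (R ρ a)) with hr
  have key : ∀ (u : Fin r → 𝔤) (φ : Fin r → V →ₗ[K] K),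
      ∃ p : MvPolynomial (Fin (finrank K V)) K, ∀ y : V,
        MvPolynomial.eval ((finBasis K V).equivFun y) p =
          (Matrix.of fun i j => φ i (R ρ y (u j))).det := by
    intro u φ
    obtain ⟨p, hp⟩ := exists_eval_finBasis_eq
      (fun ij : Fin r × Fin r => φ ij.1 ∘ₗ (R ρ).flip (u ij.2))
      (Matrix.det (Matrix.of fun i j => MvPolynomial.X (i, j)))
    refine ⟨p, fun y => ?_⟩
    rw [hp, RingHom.map_det]
    congr 1
    ext i j
    simp
  choose p hp using key
  refine ⟨Set.range fun x : (Fin r → 𝔤) × (Fin r → V →ₗ[K] K) => p x.1 x.2, fun y => ?_⟩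
  have h1 : IsRegular ρ y ↔ r ≤ finrank K (LinearMap.range (R ρ y)) := by
    rw [ha.isRegular_iff]
    exact ⟨fun h => h.ge,
      le_antisymm ((isRegular_iff_forall_finrank_range_le ρ).1 ha y)⟩
  rw [h1, ← LinearMap.exists_det_ne_zero_iff_le_finrank_range]
  simp only [Set.exists_range_iff, Prod.exists, hp]

theorem exists_isZariskiOpen_hasConstantRank_iff [IsAlgClosed K]
    [FiniteDimensional K 𝔤] [FiniteDimensional K V] :
    ∃ S : Set (V × V), IsZariskiOpen K S ∧ S.Nonempty ∧ ∀ p ∈ S,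
      (HasConstantRank (R ρ p.1) (R ρ p.2) ↔ 2 ≤ zariskiCodim K (Sing ρ)) := by
  have := IsAlgClosed.instInfinite (K := K)
  obtain ⟨S, hS⟩ := exists_isRegular_iff_exists_eval_ne_zero ρ
  obtain ⟨a₀, ha₀⟩ := exists_isRegular ρ
  obtain ⟨p₀, hp₀S, hp₀⟩ := (hS a₀).1 ha₀
  obtain ⟨d, hd, hdS⟩ := MvPolynomial.exists_forall_line_iff_two_le_height (S := S)
    ⟨p₀, hp₀S, fun h => hp₀ (by rw [h, map_zero])⟩
  let c := (finBasis K V).equivFun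
  have hSing : c '' Sing ρ = {v | ∀ p ∈ S, MvPolynomial.eval v p = 0} := by
    ext v
    rw [LinearEquiv.image_eq_preimage_symm]
    change ¬ IsRegular ρ (c.symm v) ↔ _
    rw [hS, LinearEquiv.apply_symm_apply]
    simp
  -- The left summand reads the coordinates of `a`, the second entry of the pair, to match `Sum.elim
  -- a x`.
  let l : Fin (finrank K V) ⊕ Fin (finrank K V) → V × V →ₗ[K] K :=
    Sum.elim (fun i => LinearMap.proj i ∘ₗ c.toLinearMap ∘ₗ LinearMap.snd K V V)
      fun i => LinearMap.proj i ∘ₗ c.toLinearMap ∘ₗ LinearMap.fst K V V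
  have hl : ∀ p : V × V, (fun i => l i p) = Sum.elim (c p.2) (c p.1) := fun p => by
    funext i
    cases i <;> rfl
  refine ⟨{p | MvPolynomial.eval (fun i => l i p) d ≠ 0}, isZariskiOpen_eval_ne_zero l d, ?_, ?_⟩
  · obtain ⟨w, hw⟩ : ∃ w, MvPolynomial.eval w d ≠ 0 := by
      by_contra! hall
      exact hd (MvPolynomial.funext fun c => by rw [hall, map_zero])
    refine ⟨(c.symm fun i => w (Sum.inr i), c.symm fun i => w (Sum.inl i)), ?_⟩
    change MvPolynomial.eval (fun i => l i _) d ≠ 0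
    rw [hl]
    simpa [← Function.comp_def, Sum.elim_comp_inl_inr] using hw
  · rintro ⟨x, a⟩ hxa
    change MvPolynomial.eval (fun i => l i _) d ≠ 0 at hxa
    rw [hl] at hxa
    obtain ⟨h1, h2⟩ := hdS _ _ hxa
    have ha : IsRegular ρ a := (hS a).2 h1
    rw [ha.hasConstantRank_iff, zariskiCodim, hSing, ← h2]
    refine forall_congr' fun t => ?_
    rw [hS, map_add, map_smul]

end LieRep

/-- The form without Jordan blocks need not be the one that witnesses the common type. Passing
through constant rank shows that the latter has none either, and relabelling eigenvalues does not
change this. -/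
theorem SameAlgebraicType.hasNoJordanBlocks_iff {K U V : Type*} [Field K] [Infinite K]
    [AddCommGroup U] [Module K U] [AddCommGroup V] [Module K V] {A B A' B' : U →ₗ[K] V}
    (h : SameAlgebraicType A B A' B') : HasNoJordanBlocks A B ↔ HasNoJordanBlocks A' B' := by
  obtain ⟨k, b, s, hb, hb'⟩ := h
  have hrel : ∀ i, ((b i).relabel s).IsJordan ↔ (b i).IsJordan := fun i => by
    cases b i <;> rfl
  constructor
  · intro h
    exact ⟨k, _, hb', fun i => (hrel i).not.2 (h.hasConstantRank.not_isJordan hb i)⟩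
  · intro h
    exact ⟨k, _, hb, fun i => (hrel i).not.1 (h.hasConstantRank.not_isJordan hb' i)⟩

end

theorem mainTheorem8 {K 𝔤 V : Type*} [Field K] [IsAlgClosed K] [CharZero K]
    [LieRing 𝔤] [LieAlgebra K 𝔤] [FiniteDimensional K 𝔤]
    [AddCommGroup V] [Module K V] [FiniteDimensional K V]
    (ρ : 𝔤 →ₗ⁅K⁆ Module.End K V) :
    (∀ x a : V, LieRep.IsGenericPair ρ x a →
      (HasNoJordanBlocks (LieRep.R ρ x) (LieRep.R ρ a) ↔ 2 ≤ zariskiCodim K (LieRep.Sing ρ))) ∧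
    (∃ S : Set (V × V), IsZariskiOpen K S ∧ S.Nonempty ∧ ∀ p ∈ S,
      (HasNoJordanBlocks (LieRep.R ρ p.1) (LieRep.R ρ p.2) ↔
        2 ≤ zariskiCodim K (LieRep.Sing ρ))) := by
  have := IsAlgClosed.instInfinite (K := K)
  have hiff : ∀ x a : V, HasNoJordanBlocks (LieRep.R ρ x) (LieRep.R ρ a) ↔
      HasConstantRank (LieRep.R ρ x) (LieRep.R ρ a) := fun x a =>
    ⟨HasNoJordanBlocks.hasConstantRank, HasConstantRank.hasNoJordanBlocks⟩
  obtain ⟨S, hSo, hSn, hS⟩ := LieRep.exists_isZariskiOpen_hasConstantRank_iff ρ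
  refine ⟨?_, S, hSo, hSn, fun p hp => (hiff _ _).trans (hS p hp)⟩
  rintro x a ⟨T, hTo, hxaT, hT⟩
  -- A pair `q` in both open sets has the type of `(x, a)` and satisfies the equivalence.
  obtain ⟨q, hqS, hqT⟩ := hSo.inter_nonempty hTo hSn ⟨_, hxaT⟩
  exact (hT _ hxaT q hqT).hasNoJordanBlocks_iff.trans ((hiff _ _).trans (hS q hqS))
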